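/- **Notation.** Let $f$ be a probability density on $\mathbb R$ which is positive exactly on an interval $\Omega=(x_i,x_f)$, $-\infty<x_i<x_f\le\infty$, and differentiable there with $f'<0$. All integrals are over the supports. Put $$S[f]=-\int_\Omega f\log f\,dx,\qquad \langle\log|f'|\rangle=\int_\Omega f\log|f'|\,dx,$$ $$\varphi_{p,q,\beta}[f]=\int_\Omega f^{1+p(\beta-2)}\,|f'|^{q}\,\left|\frac{p\beta}{p-q}-\frac{f f''}{(f')^2}\right|^p dx\in[0,\infty].$$ For $\alpha\in\mathbb R$ the down transform of $f$ is the density $f^{\downarrow}_\alpha(s)=f(x(s))^{\alpha}/|f'(x(s))|$ for $s\in s(\Omega)$ (and $0$ elsewhere), where $s(x)=\frac{f(x)^{2-\alpha}}{\alpha-2}$ if $\alpha\ne2$ and $s(x)=-\log f(x)$ if $\alpha=2$. The up transform of a density $h$ is $\mathfrak U_\alpha[h](u)=|(\alpha-2)x(u)|^{1/(2-\alpha)}$, $u(x)=\int_x^{x_0}|(\alpha-2)v|^{1/(\alpha-2)}h(v)\,dv$ if $\alpha\neq2$, and $\mathfrak U_2[h](u)=e^{-x(u)}$, $u(x)=\int_x^{x_0}e^v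 h(v)\,dv$, with $x_0$ in the support of $h$; it is defined up to a translation. For $p>1$, $p^*=\frac p{p-1}$, let $g_{p,1}(y)=a_p e^{-|y|^{p^*}}$ be the stretched Gaussian density, and let $g_{1,1}$ be the uniform density on an interval of length one centred at $0$. For $b\ne0$ the stretched deformed Gaussian $g_{p,b,1}$ is the density given by $g_{p,b,1}(x(y))=g_{p,1}(y)^{1/b}$, $x(y)=\int_0^y g_{p,1}(t)^{1-1/b}\,dt$, for $y$ in the support of $g_{p,1}$, and zero elsewhere. With $F_{p,b}[g]=\int|g^{b-2}g'|^p g$ and $\phi_{p,b}[g]=F_{p,b}[g]^{1/(pb)}$, set $$\kappa^{(1)}_{p,b,1}=\left(\phi_{p,b}[g_{p,b,1}]\,e^{S[g_{p,b,1}]}\right)^{b}\quad(p>1),\qquad \kappa^{(1)}_{1,b,1}=\frac2{|b|}$$ (for $p=1$ this is the same expression with $F_{1,b}[g]$ read as the total variation of $g^b/|b|$, extended by zero). **Theorem (down-Fisher–Shannon inequality).** Let $p\ge1$, $q\neq p$, $\beta$ be real numbers, and $\alpha=\frac{\beta p}{p-q}$. Let $f$ be as above, such that $f\log f$ and $f\log|f'|$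 are integrable on $\Omega$, and assume that $f^{\downarrow}_\alpha$ is absolutely continuous, in the following sense: if $q<p$, then $f^{\downarrow}_\alpha$ (extended by zero) is locally absolutely continuous on $\mathbb R$; if $q>p$, then $f^{\downarrow}_\alpha$ is locally absolutely continuous in the open interval $s(\Omega)$ and has no finite positive limit at any finite endpoint of $s(\Omega)$. Then $$\left(\varphi_{p,q,\beta}[f]\right)^{\frac1p}\,e^{\beta S[f]}\,e^{\frac{p-q}{p}\langle\log|f'|\rangle}\ \ge\ \kappa^{(1)}_{p,\frac{p-q}p,1}.$$ Moreover, equality holds only if $f$ is, up to a translation and a reflection of the variable, the up transform $\mathfrak U_{\alpha}[h]$ of a rescaled and translated stretched deformed Gaussian $h(x)=r\,g_{p,\frac{p-q}p,1}(r(x-m))$, with $r>0$ and $m\in\mathbb R$. -/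

import Mathlib

open MeasureTheory Set Filter Topology
open scoped ENNReal

noncomputable section

namespace DownFisher

/-- The open interval `(xi, xf)` with `xi` finite and `xf` finite or `+∞`. -/
def interval (xi : ℝ) (xf : EReal) : Set ℝ := {x | xi < x ∧ (x : EReal) < xf}

/-- `f` is a probability density, positive exactly on `(xi, xf)`, differentiable there with
`f' < 0`. (The value `1` of the Bochner integral forces integrability.) -/
structure IsDecreasingDensity (f : ℝ → ℝ) (xi : ℝ) (xf : EReal) : Prop where
  pos : ∀ x ∈ interval xi xf, 0 < f x
  zero : ∀ x ∉ interval xi xf, f x = 0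
  integral_eq_one : ∫ x, f x = 1
  differentiable : ∀ x ∈ interval xi xf, DifferentiableAt ℝ f x
  deriv_neg : ∀ x ∈ interval xi xf, deriv f x < 0

/-! ### Informational functionals -/

/-- Shannon entropy `S[f] = -∫ f log f`. -/
def shannon (f : ℝ → ℝ) : ℝ := -∫ x in Function.support f, f x * Real.log (f x)

/-- The mean value `⟨log |f'|⟩` with respect to the density `f`. -/
def meanLogDeriv (f : ℝ → ℝ) : ℝ :=
  ∫ x in Function.support f, f x * Real.log |deriv f x|

/-- Generalized Fisher information `F_{p,l}[f] = ∫ |f^{l-2} f'|^p f`, with values in `[0, ∞]`. -/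
def fisherF (p l : ℝ) (f : ℝ → ℝ) : ℝ≥0∞ :=
  ∫⁻ x in Function.support f, ENNReal.ofReal (|f x ^ (l - 2) * deriv f x| ^ p * f x)

/-- `φ_{p,l}[f] = F_{p,l}[f]^{1/(p l)}`. -/
def fisherPhi (p l : ℝ) (f : ℝ → ℝ) : ℝ≥0∞ := fisherF p l f ^ (1 / (p * l))

/-- The down-Fisher measure
`φ_{p,q,l}[f] = ∫ f^{1+p(l-2)} |f'|^q |p l/(p-q) - f f''/(f')²|^p`, with values in `[0, ∞]`. -/
def downFisher (p q l : ℝ) (f : ℝ → ℝ) : ℝ≥0∞ :=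
  ∫⁻ v in Function.support f, ENNReal.ofReal
    (f v ^ (1 + p * (l - 2)) * |deriv f v| ^ q *
      |p * l / (p - q) - f v * deriv (deriv f) v / deriv f v ^ 2| ^ p)

/-! ### Down and up transformations -/

/-- The canonical change of variable `s(x)` of the down transformation. -/
def downVar (α : ℝ) (f : ℝ → ℝ) (x : ℝ) : ℝ :=
  if α = 2 then -Real.log (f x) else f x ^ (2 - α) / (α - 2)

/-- The support of the down transformed density. -/
def downSupport (α : ℝ) (f : ℝ → ℝ) : Set ℝ := downVar α f '' Function.support f

open Classical in
/-- The down transformation `s ↦ f(x(s))^α / |f'(x(s))|`, extended by zero. -/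
def down (α : ℝ) (f : ℝ → ℝ) (s : ℝ) : ℝ :=
  if s ∈ downSupport α f then
    f (Function.invFunOn (downVar α f) (Function.support f) s) ^ α *
      |deriv f (Function.invFunOn (downVar α f) (Function.support f) s)|⁻¹
  else 0

/-- The change of variable `u(x)` of the up transformation, the primitive being normalized at
`x₀`; another choice of `x₀` translates the up transformed density. -/
def upVar (α : ℝ) (h : ℝ → ℝ) (x₀ x : ℝ) : ℝ :=
  if α = 2 then ∫ v in x..x₀, Real.exp v * h v
  else ∫ v in x..x₀, |(α - 2) * v| ^ (1 / (α - 2)) * h v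

open Classical in
/-- The up transformation `u ↦ |(α-2) x(u)|^{1/(2-α)}` (`u ↦ e^{-x(u)}` if `α = 2`), extended
by zero. -/
def up (α : ℝ) (h : ℝ → ℝ) (x₀ u : ℝ) : ℝ :=
  if u ∈ upVar α h x₀ '' Function.support h then
    if α = 2 then Real.exp (-Function.invFunOn (upVar α h x₀) (Function.support h) u)
    else |(α - 2) * Function.invFunOn (upVar α h x₀) (Function.support h) u| ^ (1 / (2 - α))
  else 0

/-! ### Stretched Gaussians and the optimal constant -/

/-- The stretched Gaussian `g_{p,1} = a exp(-|y|^{p*})`, `p* = p/(p-1)`, normalized to unit mass;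
for `p = 1` (`p* = ∞`), the uniform density on an interval of unit length. -/
def stretchedGaussian (p y : ℝ) : ℝ :=
  if p = 1 then (Ioo (-1 / 2 : ℝ) (1 / 2)).indicator 1 y
  else (∫ z : ℝ, Real.exp (-|z| ^ (p / (p - 1))))⁻¹ * Real.exp (-|y| ^ (p / (p - 1)))

/-- The change of variable `x(y) = ∫₀^y g_{p,1}^{1-1/b}`. -/
def gaussVar (p b y : ℝ) : ℝ := ∫ t in (0 : ℝ)..y, stretchedGaussian p t ^ (1 - 1 / b)

open Classical in
/-- The stretched deformed Gaussian `g_{p,b,1}`: it is given parametrically by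
`g_{p,b,1}(x(y)) = g_{p,1}(y)^{1/b}`, `x'(y) = g_{p,1}(y)^{1-1/b}`, on the image of the support of
`g_{p,1}`, and is extended by zero. For `b = 1` it is `g_{p,1}`. -/
def deformedGaussian (p b x : ℝ) : ℝ :=
  if x ∈ gaussVar p b '' Function.support (stretchedGaussian p) then
    stretchedGaussian p
      (Function.invFunOn (gaussVar p b) (Function.support (stretchedGaussian p)) x) ^ (1 / b)
  else 0

/-- The optimal constant `κ^{(1)}_{p,b,1} = (φ_{p,b}[g] e^{S[g]})^b`, `g = g_{p,b,1}`.
For `p = 1`, where `g` is a uniform density of unit length, `F_{1,b}[g]` is understood as the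
total variation of `g^b / |b|` extended by zero, whence the value `2 / |b|`. -/
def kappa (p b : ℝ) : ℝ≥0∞ :=
  if p = 1 then ENNReal.ofReal (2 / |b|)
  else (fisherPhi p b (deformedGaussian p b) *
    ENNReal.ofReal (Real.exp (shannon (deformedGaussian p b)))) ^ b

/-- The density `x ↦ r g(r (x - m))`. -/
def rescale (r m : ℝ) (g : ℝ → ℝ) (x : ℝ) : ℝ := r * g (r * (x - m))

/-- The regularity of the down transformed density `g = down α f`. For `q < p`, `g` (extended by
zero) is locally absolutely continuous on `ℝ`. For `q > p`, `g` is locally absolutely continuous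
in the open interval where it is positive, and has no finite positive limit at a finite endpoint
of it (as for a density which diverges at the edges of its support). -/
def RegularDown (p q α : ℝ) (f : ℝ → ℝ) : Prop :=
  (q < p → ∀ a b : ℝ, AbsolutelyContinuousOnInterval (down α f) a b) ∧
  (p < q →
    (∀ a b : ℝ, uIcc a b ⊆ downSupport α f → AbsolutelyContinuousOnInterval (down α f) a b) ∧
    ∀ e ∈ frontier (downSupport α f), ∀ L : ℝ, 0 < L →
      ¬ Tendsto (down α f) (𝓝[downSupport α f] e) (𝓝 L))

end DownFisher

end

namespace DownFisher

/-! ### Strictly monotone functions on open intervals -/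

/-! The down transform reduces the statement to a generalized Stam inequality. Put b = (p-q)/p and
let g be the down transform of f. Since g(s) ds = f(x) dx, one finds S[g] = α S[f] + ⟨log|f'|⟩
(`shannon_down`) and F_{p,b}[g] = φ_{p,q,β}[f] (`fisherF_down`). As αb = β, what remains is
F_{p,b}[g]^{1/p} e^{b S[g]} ≥ κ, which is `stam`.

That inequality is proved by mass transport. Let T be the increasing map carrying g to the stretched
Gaussian G (`exists_transport`), so T' = g/G(T). Jensen (`integral_mul_log_le`) gives S[G] - b S[g]
= ∫ g log(g^b/G(T)) ≤ log ∫ g^b T'. Integration by parts (`lintegral_mul_deriv_le`) and Hölder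
(`lintegral_mul_enorm_derivRpow_le`) give ∫ g^b T' ≤ ∫ |T| |(g^b)'| ≤ N |b| F_{p,b}[g]^{1/p}, where
N is the L^{p*}(G) norm of the identity. The constant obtained, e^{S[G]}/(N|b|), equals κ by
`kappa_eq`.

Integration by parts needs g^b to vanish at both ends. If F is finite then (g^b)' is integrable, so
g^b has finite limits there; a positive limit is excluded by the regularity hypothesis at a finite
end and by integrability of g at an infinite one.

Equality forces equality in Jensen, so g^b is a multiple of G(T). Together with T' = g/G(T) this
makes g a rescaled deformed Gaussian (`exists_eq_rescale_deformedGaussian`), and the up transform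
recovers f from g (`eq_up_down`). -/

lemma isOpen_image_of_strictMonoOn {I : Set ℝ} (hI : IsOpen I) (hc : I.OrdConnected)
    {X : ℝ → ℝ} (hX : StrictMonoOn X I) (hXc : ContinuousOn X I) : IsOpen (X '' I) := by
  rw [isOpen_iff_mem_nhds]
  rintro _ ⟨x, hx, rfl⟩
  obtain ⟨ε, hε, hb⟩ := Metric.isOpen_iff.1 hI x hx
  have ha : x - ε / 2 ∈ I := hb (by rw [Real.ball_eq_Ioo]; constructor <;> linarith)
  have hb' : x + ε / 2 ∈ I := hb (by rw [Real.ball_eq_Ioo]; constructor <;> linarith)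
  have hs : Icc (x - ε / 2) (x + ε / 2) ⊆ I := hc.out ha hb'
  refine mem_of_superset (Ioo_mem_nhds (hX ha hx (by linarith)) (hX hx hb' (by linarith))) ?_
  exact (intermediate_value_Ioo (by linarith) (hXc.mono hs)).trans
    (image_mono (Ioo_subset_Icc_self.trans hs))

lemma ordConnected_image {I : Set ℝ} (hc : I.OrdConnected) {X : ℝ → ℝ}
    (hXc : ContinuousOn X I) : (X '' I).OrdConnected :=
  (hc.isPreconnected.image X hXc).ordConnected

/-- Differentiates a function known only parametrically. The inverse of `X` is monotone with open
image, hence continuous, so the inverse function rule and the chain rule apply. It serves for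
inverse maps (`φ = id`) and for the deformed Gaussian. -/
lemma hasDerivAt_of_comp_eq {I : Set ℝ} (hI : IsOpen I) (hc : I.OrdConnected)
    {X φ D : ℝ → ℝ} (hX : StrictMonoOn X I) (hXc : ContinuousOn X I)
    (hD : ∀ z ∈ I, D (X z) = φ z) {y X' φ' : ℝ} (hy : y ∈ I) (hX' : HasDerivAt X X' y)
    (h0 : X' ≠ 0) (hφ : HasDerivAt φ φ' y) : HasDerivAt D (φ' / X') (X y) := by
  have hopen := isOpen_image_of_strictMonoOn hI hc hX hXc
  have hnhds : X '' I ∈ 𝓝 (X y) := hopen.mem_nhds (mem_image_of_mem X hy)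
  set ψ := Function.invFunOn X I with hψ
  have hleft : ∀ z ∈ I, ψ (X z) = z := fun z hz => hX.injOn.leftInvOn_invFunOn hz
  have himg : ψ '' (X '' I) = I := by
    rw [image_image]
    exact (image_congr hleft).trans (image_id' I)
  have hmono : StrictMonoOn ψ (X '' I) := by
    rintro _ ⟨a, ha, rfl⟩ _ ⟨b, hb, rfl⟩ hab
    rw [hleft a ha, hleft b hb]
    exact (hX.lt_iff_lt ha hb).1 hab
  have hcont : ContinuousAt ψ (X y) := by
    refine hmono.continuousAt_of_image_mem_nhds hnhds ?_
    rw [himg, hleft y hy]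
    exact hI.mem_nhds hy
  have hinv : HasDerivAt ψ X'⁻¹ (X y) := by
    refine HasDerivAt.of_local_left_inverse hcont (by rwa [hleft y hy]) h0 ?_
    filter_upwards [hnhds]
    rintro _ ⟨a, ha, rfl⟩
    rw [hleft a ha]
  have hcomp : HasDerivAt (φ ∘ ψ) (φ' * X'⁻¹) (X y) :=
    HasDerivAt.comp (X y) (by rwa [hleft y hy]) hinv
  rw [div_eq_mul_inv]
  refine hcomp.congr_of_eventuallyEq ?_
  filter_upwards [hnhds]
  rintro _ ⟨a, ha, rfl⟩
  rw [Function.comp_apply, hleft a ha, hD a ha]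

lemma strictMonoOn_of_hasDerivAt_pos {I : Set ℝ} (hc : I.OrdConnected) {X X' : ℝ → ℝ}
    (hX : ∀ x ∈ I, HasDerivAt X (X' x) x) (hpos : ∀ x ∈ I, 0 < X' x) : StrictMonoOn X I := by
  refine strictMonoOn_of_deriv_pos hc.convex
    (fun x hx => (hX x hx).continuousAt.continuousWithinAt) fun x hx => ?_
  rw [(hX x (interior_subset hx)).deriv]
  exact hpos x (interior_subset hx)

lemma exists_eq_add_const_of_hasDerivAt {I : Set ℝ} (hc : I.OrdConnected) {A B d : ℝ → ℝ}
    (hA : ∀ x ∈ I, HasDerivAt A (d x) x) (hB : ∀ x ∈ I, HasDerivAt B (d x) x) :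
    ∃ k, ∀ x ∈ I, A x = B x + k := by
  rcases I.eq_empty_or_nonempty with rfl | ⟨x₀, hx₀⟩
  · exact ⟨0, by simp⟩
  refine ⟨A x₀ - B x₀, fun x hx => ?_⟩
  have := hc.convex.is_const_of_fderivWithin_eq_zero (𝕜 := ℝ) (f := fun x => A x - B x)
    (fun y hy => ((hA y hy).sub (hB y hy)).differentiableAt.differentiableWithinAt) ?_ hx hx₀
  · have h : A x - B x = A x₀ - B x₀ := this
    linarith
  · intro y hy
    by_cases hu : UniqueDiffWithinAt ℝ I y
    · have h := ((hA y hy).sub (hB y hy)).hasDerivWithinAt (s := I)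
      rw [sub_self] at h
      have h2 := h.hasFDerivWithinAt.fderivWithin hu
      rw [show (fun x => A x - B x) = A - B from rfl, h2]
      simp
    -- This happens only when `I` is a single point; the derivative within `I` is then zero by
    -- convention.
    · exact fderivWithin_zero_of_not_uniqueDiffWithinAt hu

/-! ### Continuous densities that are positive on an open interval -/

/-- `g` is a probability density, positive and continuous on the open interval `I` and zero
elsewhere. -/
structure IsIntervalDensity (g : ℝ → ℝ) (I : Set ℝ) : Prop where
  isOpen : IsOpen I
  ordConnected : I.OrdConnected
  pos : ∀ x ∈ I, 0 < g x
  zero : ∀ x ∉ I, g x = 0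
  continuousOn : ContinuousOn g I
  integral_eq_one : ∫ x, g x = 1

namespace IsIntervalDensity

variable {g : ℝ → ℝ} {I : Set ℝ}

lemma integrable (h : IsIntervalDensity g I) : Integrable g := by
  by_contra hn
  have := h.integral_eq_one
  rw [integral_undef hn] at this
  exact zero_ne_one this

lemma nonneg (h : IsIntervalDensity g I) (x : ℝ) : 0 ≤ g x := by
  by_cases hx : x ∈ I
  · exact (h.pos x hx).le
  · exact (h.zero x hx).ge

lemma support_eq (h : IsIntervalDensity g I) : Function.support g = I := by
  ext x
  by_cases hx : x ∈ I
  · simp [hx, (h.pos x hx).ne']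
  · simp [hx, h.zero x hx]

lemma setIntegral_eq_one (h : IsIntervalDensity g I) : ∫ x in I, g x = 1 := by
  rw [setIntegral_eq_integral_of_forall_compl_eq_zero h.zero, h.integral_eq_one]

lemma continuousAt (h : IsIntervalDensity g I) {x : ℝ} (hx : x ∈ I) : ContinuousAt g x :=
  h.continuousOn.continuousAt (h.isOpen.mem_nhds hx)

lemma nonempty (h : IsIntervalDensity g I) : I.Nonempty := by
  by_contra hn
  rw [not_nonempty_iff_eq_empty] at hn
  have := h.setIntegral_eq_one
  simp [hn] at this

lemma exists_lt (h : IsIntervalDensity g I) {x : ℝ} (hx : x ∈ I) : ∃ y ∈ I, y < x :=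
  let ⟨_, h1, h2⟩ := ((h.isOpen.eventually_mem hx).filter_mono nhdsWithin_le_nhds
    |>.and (self_mem_nhdsWithin (s := Iio x))).exists
  ⟨_, h1, h2⟩

lemma exists_gt (h : IsIntervalDensity g I) {x : ℝ} (hx : x ∈ I) : ∃ y ∈ I, x < y :=
  let ⟨_, h1, h2⟩ := ((h.isOpen.eventually_mem hx).filter_mono nhdsWithin_le_nhds
    |>.and (self_mem_nhdsWithin (s := Ioi x))).exists
  ⟨_, h1, h2⟩

end IsIntervalDensity

/-- The distribution function of a density. -/
noncomputable def distrib (g : ℝ → ℝ) (x : ℝ) : ℝ := ∫ t in Iic x, g t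

namespace IsIntervalDensity

variable {g : ℝ → ℝ} {I : Set ℝ}

lemma distrib_sub (h : IsIntervalDensity g I) (a b : ℝ) :
    distrib g b - distrib g a = ∫ t in a..b, g t :=
  intervalIntegral.integral_Iic_sub_Iic h.integrable.integrableOn h.integrable.integrableOn

lemma hasDerivAt_distrib (h : IsIntervalDensity g I) {x : ℝ} (hx : x ∈ I) :
    HasDerivAt (distrib g) (g x) x := by
  have h1 : distrib g = fun y => distrib g x + ∫ t in x..y, g t := by
    funext y; rw [← h.distrib_sub]; ring
  rw [h1]
  exact (intervalIntegral.integral_hasDerivAt_right (h.integrable.intervalIntegrable)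
    (h.integrable.aestronglyMeasurable.stronglyMeasurableAtFilter) (h.continuousAt hx)).const_add _

lemma continuous_distrib (h : IsIntervalDensity g I) : Continuous (distrib g) := by
  have h1 : distrib g = fun y => distrib g 0 + ∫ t in (0 : ℝ)..y, g t := by
    funext y; rw [← h.distrib_sub]; ring
  rw [h1]
  exact continuous_const.add (intervalIntegral.continuous_primitive
    (fun _ _ => h.integrable.intervalIntegrable) 0)

lemma strictMonoOn_distrib (h : IsIntervalDensity g I) : StrictMonoOn (distrib g) I :=
  strictMonoOn_of_hasDerivAt_pos h.ordConnected (fun _ hx => h.hasDerivAt_distrib hx) h.pos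

lemma distrib_nonneg (h : IsIntervalDensity g I) (x : ℝ) : 0 ≤ distrib g x :=
  integral_nonneg h.nonneg

lemma distrib_le_one (h : IsIntervalDensity g I) (x : ℝ) : distrib g x ≤ 1 := by
  rw [← h.integral_eq_one]
  exact setIntegral_le_integral h.integrable (Eventually.of_forall h.nonneg)

/-- Points of `I` on either side keep the value strictly between 0 and 1. Conversely the
intermediate value theorem on the whole line attains each such value, and outside `I` the
distribution function is 0 or 1. -/
lemma image_distrib (h : IsIntervalDensity g I) : distrib g '' I = Ioo 0 1 := by
  apply Subset.antisymm
  · rintro _ ⟨x, hx, rfl⟩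
    obtain ⟨y, hy, hyx⟩ := h.exists_lt hx
    obtain ⟨z, hz, hxz⟩ := h.exists_gt hx
    exact ⟨(h.distrib_nonneg y).trans_lt (h.strictMonoOn_distrib hy hx hyx),
      (h.strictMonoOn_distrib hx hz hxz).trans_le (h.distrib_le_one z)⟩
  · intro t ht
    have hbot : Tendsto (distrib g) atBot (𝓝 0) := by
      have h2 := tendsto_setIntegral_of_antitone (μ := volume) (f := g) (s := fun n : ℝ => Iic (-n))
        (fun _ => measurableSet_Iic) (fun a b hab => Iic_subset_Iic.2 (by linarith))
        ⟨0, h.integrable.integrableOn⟩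
      have h3 : (⋂ n : ℝ, Iic (-n)) = (∅ : Set ℝ) := by
        ext y
        simp only [mem_iInter, mem_Iic, mem_empty_iff_false, iff_false, not_forall, not_le]
        exact ⟨-y + 1, by linarith⟩
      rw [h3, setIntegral_empty] at h2
      have h4 := h2.comp tendsto_neg_atBot_atTop
      refine h4.congr fun y => ?_
      simp [distrib]
    have htop : Tendsto (distrib g) atTop (𝓝 1) := by
      have h2 := tendsto_setIntegral_of_monotone (μ := volume) (f := g) (s := fun n : ℝ => Iic n)
        (fun _ => measurableSet_Iic) (fun a b hab => Iic_subset_Iic.2 hab)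
        h.integrable.integrableOn
      have h3 : (⋃ n : ℝ, Iic n) = (univ : Set ℝ) := iUnion_Iic
      rw [h3, setIntegral_univ, h.integral_eq_one] at h2
      exact h2
    obtain ⟨a, ha⟩ := (hbot.eventually (gt_mem_nhds ht.1)).exists
    obtain ⟨b, hb⟩ := (htop.eventually (lt_mem_nhds ht.2)).exists
    obtain ⟨x, -, hx⟩ := (isPreconnected_univ).intermediate_value (mem_univ a) (mem_univ b)
      h.continuous_distrib.continuousOn ⟨ha.le, hb.le⟩
    refine ⟨x, ?_, hx⟩
    by_contra hxI
    obtain ⟨i, hi⟩ := h.nonempty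
    rcases lt_or_gt_of_ne (fun e : i = x => hxI (e ▸ hi)) with hix | hix
    · have : distrib g x = ∫ t, g t := by
        refine setIntegral_eq_integral_of_forall_compl_eq_zero fun y hy => h.zero y fun hyI => hxI ?_
        exact h.ordConnected.out hi hyI ⟨hix.le, (not_le.1 hy).le⟩
      rw [this, h.integral_eq_one] at hx
      exact ht.2.ne hx.symm
    · have : distrib g x = 0 := by
        refine setIntegral_eq_zero_of_forall_eq_zero fun y hy => h.zero y fun hyI => hxI ?_
        exact h.ordConnected.out hyI hi ⟨hy, hix.le⟩
      rw [this] at hx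
      exact ht.1.ne hx

end IsIntervalDensity

/-! ### Monotone transport -/

/-- The increasing map of `I` onto `J` that transports the density `g` on `I` to the density `G`
on `J`. -/
theorem exists_transport {g G : ℝ → ℝ} {I J : Set ℝ} (hg : IsIntervalDensity g I)
    (hG : IsIntervalDensity G J) :
    ∃ T : ℝ → ℝ, StrictMonoOn T I ∧ T '' I = J ∧
      ∀ s ∈ I, HasDerivAt T (g s / G (T s)) s := by
  set T := fun s => Function.invFunOn (distrib G) J (distrib g s) with hT
  have hmem : ∀ s ∈ I, ∃ y ∈ J, distrib G y = distrib g s := fun s hs => by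
    have : distrib g s ∈ distrib G '' J := by
      rw [hG.image_distrib, ← hg.image_distrib]; exact mem_image_of_mem _ hs
    exact this
  have hTJ : ∀ s ∈ I, T s ∈ J := fun s hs => Function.invFunOn_mem (hmem s hs)
  have hTe : ∀ s ∈ I, distrib G (T s) = distrib g s := fun s hs => Function.invFunOn_eq (hmem s hs)
  have hmono : StrictMonoOn T I := by
    intro a ha b hb hab
    rw [← hG.strictMonoOn_distrib.lt_iff_lt (hTJ a ha) (hTJ b hb), hTe a ha, hTe b hb]
    exact hg.strictMonoOn_distrib ha hb hab
  refine ⟨T, hmono, ?_, fun s hs => ?_⟩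
  · refine Subset.antisymm (image_subset_iff.2 hTJ) fun y hy => ?_
    have : distrib G y ∈ distrib g '' I := by
      rw [hg.image_distrib, ← hG.image_distrib]; exact mem_image_of_mem _ hy
    obtain ⟨s, hs, hse⟩ := this
    exact ⟨s, hs, hG.strictMonoOn_distrib.injOn (hTJ s hs) hy (by rw [hTe s hs, hse])⟩
  · have h1 := hasDerivAt_of_comp_eq hG.isOpen hG.ordConnected (D := Function.invFunOn (distrib G) J)
      (φ := id) hG.strictMonoOn_distrib hG.continuous_distrib.continuousOn
      (fun z hz => hG.strictMonoOn_distrib.injOn.leftInvOn_invFunOn hz) (hTJ s hs)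
      (hG.hasDerivAt_distrib (hTJ s hs)) (hG.pos _ (hTJ s hs)).ne' (hasDerivAt_id _)
    rw [hTe s hs] at h1
    have h2 := HasDerivAt.comp s h1 (hg.hasDerivAt_distrib hs)
    exact h2.congr_deriv (by rw [one_div, inv_mul_eq_div])

/-! ### The stretched Gaussian -/

lemma integrable_comp_abs {f : ℝ → ℝ} (hf : IntegrableOn f (Ioi 0)) :
    Integrable fun x => f |x| := by
  have h1 : IntegrableOn (fun x => f |x|) (Ioi 0) :=
    hf.congr_fun (fun x hx => by rw [abs_of_pos hx]) measurableSet_Ioi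
  have h2 : IntegrableOn (fun x => f |x|) (Iic 0) := by
    rw [← Measure.map_neg_eq_self (volume : Measure ℝ)]
    let m : MeasurableEmbedding fun x : ℝ => -x := (Homeomorph.neg ℝ).measurableEmbedding
    rw [m.integrableOn_map_iff]
    simp_rw [Function.comp_def, abs_neg, neg_preimage, neg_Iic, neg_zero]
    exact (integrableOn_Ici_iff_integrableOn_Ioi).mpr h1
  have := h2.union h1
  rwa [Iic_union_Ioi, integrableOn_univ] at this

/-- The support of the stretched Gaussian. -/
noncomputable def gaussSupport (p : ℝ) : Set ℝ := if p = 1 then Ioo (-1 / 2) (1 / 2) else univ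

/-- The `L^{p*}` norm of the identity for the stretched Gaussian density. -/
noncomputable def gaussNorm (p : ℝ) : ℝ :=
  if p = 1 then 1 / 2 else ((p - 1) / p) ^ ((p - 1) / p)

lemma gaussNorm_pos {p : ℝ} (hp : 1 ≤ p) : 0 < gaussNorm p := by
  rw [gaussNorm]
  split_ifs with h
  · norm_num
  · have h1 : 1 < p := lt_of_le_of_ne hp (Ne.symm h)
    exact Real.rpow_pos_of_pos (div_pos (by linarith) (by linarith)) _

section Exponential

variable {c : ℝ}

lemma integrable_exp_neg_abs_rpow (hc : 1 < c) :
    Integrable fun z : ℝ => Real.exp (-|z| ^ c) := by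
  have := integrableOn_rpow_mul_exp_neg_rpow (p := c) (s := 0) (by norm_num) (by linarith)
  simp only [Real.rpow_zero, one_mul] at this
  exact integrable_comp_abs this

lemma integrable_abs_rpow_mul_exp (hc : 1 < c) :
    Integrable fun z : ℝ => |z| ^ c * Real.exp (-|z| ^ c) :=
  integrable_comp_abs (integrableOn_rpow_mul_exp_neg_rpow (p := c) (s := c) (by linarith)
    (by linarith))

lemma integral_exp_neg_abs_rpow_pos (hc : 1 < c) :
    0 < ∫ z : ℝ, Real.exp (-|z| ^ c) :=
  integral_exp_pos (integrable_exp_neg_abs_rpow hc)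

/-- Both sides are Gamma integrals, related by Γ(1 + 1/c) = Γ(1/c)/c. -/
lemma integral_abs_rpow_mul_exp (hc : 1 < c) :
    ∫ z : ℝ, |z| ^ c * Real.exp (-|z| ^ c) = (1 / c) * ∫ z : ℝ, Real.exp (-|z| ^ c) := by
  have h0 : 0 < c := by linarith
  have h1 := integral_rpow_mul_exp_neg_rpow (p := c) (q := 0) h0 (by norm_num)
  have h2 := integral_rpow_mul_exp_neg_rpow (p := c) (q := c) h0 (by linarith)
  simp only [Real.rpow_zero, one_mul] at h1
  rw [integral_comp_abs (f := fun x => x ^ c * Real.exp (-x ^ c)),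
    integral_comp_abs (f := fun x => Real.exp (-x ^ c)), h1, h2, add_div, div_self h0.ne',
    add_comm 1, zero_add, Real.Gamma_add_one (by positivity)]
  ring

end Exponential

lemma one_lt_conj {p : ℝ} (hp : 1 < p) : 1 < p / (p - 1) := by
  rw [lt_div_iff₀ (by linarith)]; linarith

lemma stretchedGaussian_of_ne {p : ℝ} (hp : p ≠ 1) (y : ℝ) : stretchedGaussian p y =
    (∫ z : ℝ, Real.exp (-|z| ^ (p / (p - 1))))⁻¹ * Real.exp (-|y| ^ (p / (p - 1))) := by
  rw [stretchedGaussian, if_neg hp]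

lemma stretchedGaussian_one_of_mem {y : ℝ} (hy : y ∈ gaussSupport 1) :
    stretchedGaussian 1 y = 1 := by
  rw [gaussSupport, if_pos rfl] at hy
  rw [stretchedGaussian, if_pos rfl, indicator_of_mem hy, Pi.one_apply]

lemma isIntervalDensity_stretchedGaussian {p : ℝ} (hp : 1 ≤ p) :
    IsIntervalDensity (stretchedGaussian p) (gaussSupport p) := by
  rcases hp.eq_or_lt with rfl | hp1
  · have hg : stretchedGaussian 1 = (Ioo (-1 / 2 : ℝ) (1 / 2)).indicator 1 := by
      funext y; simp [stretchedGaussian]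
    have hs : gaussSupport 1 = Ioo (-1 / 2 : ℝ) (1 / 2) := by simp [gaussSupport]
    rw [hg, hs]
    refine ⟨isOpen_Ioo, ordConnected_Ioo, fun x hx => ?_, fun x hx => ?_, ?_, ?_⟩
    · rw [indicator_of_mem hx]; exact one_pos
    · rw [indicator_of_notMem hx]
    · exact (continuousOn_const (c := (1 : ℝ))).congr fun x hx => by
        rw [indicator_of_mem hx]; rfl
    · rw [integral_indicator_one measurableSet_Ioo]
      norm_num [measureReal_def]
  · have hc := one_lt_conj hp1
    have hs : gaussSupport p = univ := by simp [gaussSupport, hp1.ne']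
    have hZ := integral_exp_neg_abs_rpow_pos hc
    rw [hs]
    refine ⟨isOpen_univ, ordConnected_univ, fun x _ => ?_, fun x hx => (hx trivial).elim, ?_, ?_⟩
    · rw [stretchedGaussian_of_ne hp1.ne']
      positivity
    · refine Continuous.continuousOn ?_
      rw [show stretchedGaussian p = _ from funext (stretchedGaussian_of_ne hp1.ne')]
      have : Continuous fun y : ℝ => |y| ^ (p / (p - 1)) :=
        continuous_abs.rpow_const fun _ => Or.inr (by linarith)
      fun_prop
    · simp_rw [stretchedGaussian_of_ne hp1.ne']
      rw [integral_const_mul, inv_mul_cancel₀ hZ.ne']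

lemma log_stretchedGaussian {p : ℝ} (hp : 1 < p) (y : ℝ) : Real.log (stretchedGaussian p y) =
    -Real.log (∫ z : ℝ, Real.exp (-|z| ^ (p / (p - 1)))) - |y| ^ (p / (p - 1)) := by
  rw [stretchedGaussian_of_ne hp.ne', Real.log_mul
    (inv_ne_zero (integral_exp_neg_abs_rpow_pos (one_lt_conj hp)).ne') (Real.exp_pos _).ne',
    Real.log_exp, Real.log_inv]
  ring

lemma integrable_abs_rpow_mul_stretchedGaussian {p : ℝ} (hp : 1 < p) :
    Integrable fun y => |y| ^ (p / (p - 1)) * stretchedGaussian p y := by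
  simp_rw [stretchedGaussian_of_ne hp.ne', mul_left_comm (|_| ^ _)]
  exact (integrable_abs_rpow_mul_exp (one_lt_conj hp)).const_mul _

lemma integral_abs_rpow_mul_stretchedGaussian {p : ℝ} (hp : 1 < p) :
    ∫ y, |y| ^ (p / (p - 1)) * stretchedGaussian p y = (p - 1) / p := by
  simp_rw [stretchedGaussian_of_ne hp.ne', mul_left_comm (|_| ^ _)]
  rw [integral_const_mul, integral_abs_rpow_mul_exp (one_lt_conj hp), mul_left_comm,
    inv_mul_cancel₀ (integral_exp_neg_abs_rpow_pos (one_lt_conj hp)).ne', mul_one, one_div_div]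

lemma integrableOn_stretchedGaussian_mul_log {p : ℝ} (hp : 1 ≤ p) :
    IntegrableOn (fun y => stretchedGaussian p y * Real.log (stretchedGaussian p y))
      (gaussSupport p) := by
  have hG := isIntervalDensity_stretchedGaussian hp
  rcases hp.eq_or_lt with rfl | hp1
  · refine integrableOn_zero.congr_fun (fun y hy => ?_) hG.isOpen.measurableSet
    simp [stretchedGaussian_one_of_mem hy]
  · refine Integrable.integrableOn ?_
    have h := (hG.integrable.mul_const
      (-Real.log (∫ z : ℝ, Real.exp (-|z| ^ (p / (p - 1)))))).sub
      (integrable_abs_rpow_mul_stretchedGaussian hp1)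
    refine h.congr (Eventually.of_forall fun y => ?_)
    simp only [Pi.sub_apply, log_stretchedGaussian hp1]
    ring

/-- The entropy of the stretched Gaussian. -/
noncomputable def gaussEntropy (p : ℝ) : ℝ :=
  -∫ y in gaussSupport p, stretchedGaussian p y * Real.log (stretchedGaussian p y)

lemma gaussEntropy_one : gaussEntropy 1 = 0 := by
  rw [gaussEntropy, setIntegral_eq_zero_of_forall_eq_zero, neg_zero]
  intro y hy
  simp [stretchedGaussian_one_of_mem hy]

lemma hasDerivAt_stretchedGaussian {p : ℝ} (hp : 1 < p) (y : ℝ) :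
    HasDerivAt (stretchedGaussian p)
      (-(p / (p - 1) * |y| ^ (p / (p - 1) - 2) * y) * stretchedGaussian p y) y := by
  rw [show stretchedGaussian p = _ from funext (stretchedGaussian_of_ne hp.ne')]
  refine (((hasDerivAt_abs_rpow y (one_lt_conj hp)).neg.exp).const_mul _).congr_deriv ?_
  simp only [Pi.neg_apply]
  ring

/-! ### The deformed Gaussian -/

section Deformed

variable {p b : ℝ}

lemma zero_mem_gaussSupport : (0 : ℝ) ∈ gaussSupport p := by
  rw [gaussSupport]; split_ifs <;> norm_num

lemma hasDerivAt_gaussVar (hp : 1 ≤ p) {y : ℝ} (hy : y ∈ gaussSupport p) :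
    HasDerivAt (gaussVar p b) (stretchedGaussian p y ^ (1 - 1 / b)) y := by
  have hG := isIntervalDensity_stretchedGaussian hp
  have hc : ContinuousOn (fun t => stretchedGaussian p t ^ (1 - 1 / b)) (gaussSupport p) :=
    hG.continuousOn.rpow_const fun x hx => Or.inl (hG.pos x hx).ne'
  refine intervalIntegral.integral_hasDerivAt_right
    (hc.mono (hG.ordConnected.uIcc_subset zero_mem_gaussSupport hy)).intervalIntegrable
    (hc.stronglyMeasurableAtFilter hG.isOpen _ hy) (hc.continuousAt (hG.isOpen.mem_nhds hy))

lemma continuousOn_gaussVar (hp : 1 ≤ p) : ContinuousOn (gaussVar p b) (gaussSupport p) :=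
  fun _ hy => (hasDerivAt_gaussVar hp hy).continuousAt.continuousWithinAt

lemma strictMonoOn_gaussVar (hp : 1 ≤ p) : StrictMonoOn (gaussVar p b) (gaussSupport p) :=
  have hG := isIntervalDensity_stretchedGaussian hp
  strictMonoOn_of_hasDerivAt_pos hG.ordConnected (fun _ hy => hasDerivAt_gaussVar hp hy)
    fun _ hy => Real.rpow_pos_of_pos (hG.pos _ hy) _

lemma deformedGaussian_gaussVar (hp : 1 ≤ p) {y : ℝ} (hy : y ∈ gaussSupport p) :
    deformedGaussian p b (gaussVar p b y) = stretchedGaussian p y ^ (1 / b) := by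
  have hG := isIntervalDensity_stretchedGaussian hp
  rw [deformedGaussian, hG.support_eq, if_pos (mem_image_of_mem _ hy),
    (strictMonoOn_gaussVar hp).injOn.leftInvOn_invFunOn hy]

lemma deformedGaussian_of_notMem (hp : 1 ≤ p) {x : ℝ} (hx : x ∉ gaussVar p b '' gaussSupport p) :
    deformedGaussian p b x = 0 := by
  rw [deformedGaussian, (isIntervalDensity_stretchedGaussian hp).support_eq, if_neg hx]

lemma support_deformedGaussian (hp : 1 ≤ p) :
    Function.support (deformedGaussian p b) = gaussVar p b '' gaussSupport p := by
  have hG := isIntervalDensity_stretchedGaussian hp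
  ext x
  by_cases hx : x ∈ gaussVar p b '' gaussSupport p
  · obtain ⟨y, hy, rfl⟩ := hx
    simp only [Function.mem_support, deformedGaussian_gaussVar hp hy, mem_image_of_mem _ hy,
      iff_true]
    exact (Real.rpow_pos_of_pos (hG.pos y hy) _).ne'
  · simp [hx, deformedGaussian_of_notMem hp hx]

lemma deriv_deformedGaussian (hp : 1 < p) (y : ℝ) :
    deriv (deformedGaussian p b) (gaussVar p b y) =
      -(p / (p - 1) * |y| ^ (p / (p - 1) - 2) * y) * stretchedGaussian p y * (1 / b) *
        stretchedGaussian p y ^ (1 / b - 1) / stretchedGaussian p y ^ (1 - 1 / b) := by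
  have hG := isIntervalDensity_stretchedGaussian hp.le
  have hy : y ∈ gaussSupport p := by simp [gaussSupport, hp.ne']
  exact (hasDerivAt_of_comp_eq hG.isOpen hG.ordConnected (strictMonoOn_gaussVar hp.le)
    (continuousOn_gaussVar hp.le) (fun z hz => deformedGaussian_gaussVar hp.le hz) hy
    (hasDerivAt_gaussVar hp.le hy) (Real.rpow_pos_of_pos (hG.pos y hy) _).ne'
    ((hasDerivAt_stretchedGaussian hp y).rpow_const (Or.inl (hG.pos y hy).ne'))).deriv

lemma shannon_deformedGaussian (hp : 1 < p) :
    shannon (deformedGaussian p b) = gaussEntropy p / b := by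
  have hG := isIntervalDensity_stretchedGaussian hp.le
  rw [shannon, support_deformedGaussian hp.le, integral_image_eq_integral_abs_deriv_smul
    hG.isOpen.measurableSet (fun y hy => (hasDerivAt_gaussVar hp.le hy).hasDerivWithinAt)
    (strictMonoOn_gaussVar hp.le).injOn, gaussEntropy, neg_div, ← integral_div]
  congr 1
  refine setIntegral_congr_fun hG.isOpen.measurableSet fun y hy => ?_
  have hw := hG.pos y hy
  simp only [smul_eq_mul]
  rw [deformedGaussian_gaussVar hp.le hy, abs_of_pos (Real.rpow_pos_of_pos hw _),
    Real.log_rpow hw, ← mul_assoc, ← Real.rpow_add hw, sub_add_cancel, Real.rpow_one]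
  ring

lemma abs_rpow_sub_two_mul_self {c : ℝ} (hc : 1 < c) (y : ℝ) :
    |y| ^ (c - 2) * |y| = |y| ^ (c - 1) := by
  rcases eq_or_ne y 0 with rfl | hy
  · rw [abs_zero, mul_zero, Real.zero_rpow (by linarith)]
  · have := Real.rpow_add_one (abs_ne_zero.2 hy) (c - 2)
    rw [← this]; congr 1; ring

/-- The deformation is designed for this cancellation: along the parametrization, g^{b-2} g' becomes
G'/(bG), the logarithmic derivative of the stretched Gaussian divided by b. -/
lemma rpow_deformation_identity (hb : b ≠ 0) {w : ℝ} (hw : 0 < w) :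
    (w ^ (1 / b)) ^ (b - 2) * (w * w ^ (1 / b - 1) / w ^ (1 - 1 / b)) = 1 := by
  nth_rewrite 2 [← Real.rpow_one w]
  rw [← Real.rpow_mul hw.le, ← Real.rpow_add hw, ← Real.rpow_sub hw, ← Real.rpow_add hw]
  rw [show 1 / b * (b - 2) + (1 + (1 / b - 1) - (1 - 1 / b)) = 0 by field_simp; ring,
    Real.rpow_zero]

/-- In the parameter y the integrand is a constant times |y|^{(p*-1)p} G = |y|^{p*} G, whose
integral is the moment 1/p*. -/
lemma fisherF_deformedGaussian (hp : 1 < p) (hb : b ≠ 0) :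
    fisherF p b (deformedGaussian p b) =
      ENNReal.ofReal ((p / (p - 1) / |b|) ^ p * ((p - 1) / p)) := by
  have hG := isIntervalDensity_stretchedGaussian hp.le
  have hc := one_lt_conj hp
  have hp0 : 0 < p - 1 := by linarith
  have hs : gaussSupport p = univ := by simp [gaussSupport, hp.ne']
  rw [fisherF, support_deformedGaussian hp.le, lintegral_image_eq_lintegral_abs_deriv_mul
    hG.isOpen.measurableSet (fun y hy => (hasDerivAt_gaussVar hp.le hy).hasDerivWithinAt)
    (strictMonoOn_gaussVar hp.le).injOn]
  have key : ∀ y ∈ gaussSupport p, ENNReal.ofReal |stretchedGaussian p y ^ (1 - 1 / b)| *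
      ENNReal.ofReal (|deformedGaussian p b (gaussVar p b y) ^ (b - 2) *
        deriv (deformedGaussian p b) (gaussVar p b y)| ^ p *
        deformedGaussian p b (gaussVar p b y)) =
      ENNReal.ofReal ((p / (p - 1) / |b|) ^ p *
        (|y| ^ (p / (p - 1)) * stretchedGaussian p y)) := by
    intro y hy
    have hw := hG.pos y hy
    have h1 : stretchedGaussian p y ^ (1 - 1 / b) * stretchedGaussian p y ^ (1 / b) =
        stretchedGaussian p y := by
      rw [← Real.rpow_add hw, sub_add_cancel, Real.rpow_one]
    have h2 : |deformedGaussian p b (gaussVar p b y) ^ (b - 2) *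
        deriv (deformedGaussian p b) (gaussVar p b y)| =
        p / (p - 1) / |b| * |y| ^ (p / (p - 1) - 1) := by
      rw [deformedGaussian_gaussVar hp.le hy, deriv_deformedGaussian hp]
      have := rpow_deformation_identity hb hw
      calc _ = |(stretchedGaussian p y ^ (1 / b)) ^ (b - 2) *
            (stretchedGaussian p y * stretchedGaussian p y ^ (1 / b - 1) /
              stretchedGaussian p y ^ (1 - 1 / b)) *
            (-(p / (p - 1) * (|y| ^ (p / (p - 1) - 2) * y)) * (1 / b))| := by
            congr 1; ring
        _ = _ := by
            rw [this, one_mul, abs_mul, abs_neg, abs_mul, abs_mul _ y, abs_div 1, abs_one,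
              abs_of_pos (show 0 < p / (p - 1) by positivity),
              abs_of_nonneg (Real.rpow_nonneg (abs_nonneg y) _),
              abs_rpow_sub_two_mul_self hc]
            ring
    rw [← ENNReal.ofReal_mul (abs_nonneg _), h2, deformedGaussian_gaussVar hp.le hy,
      abs_of_pos (Real.rpow_pos_of_pos hw _), mul_left_comm, h1,
      Real.mul_rpow (by positivity) (by positivity), ← Real.rpow_mul (abs_nonneg y),
      show (p / (p - 1) - 1) * p = p / (p - 1) by field_simp; ring, mul_assoc]
  rw [setLIntegral_congr_fun hG.isOpen.measurableSet key, hs, setLIntegral_univ,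
    ← ofReal_integral_eq_lintegral_ofReal
      ((integrable_abs_rpow_mul_stretchedGaussian hp).const_mul _)
      (Eventually.of_forall fun y => by
        have := hG.nonneg y
        positivity), integral_const_mul, integral_abs_rpow_mul_stretchedGaussian hp]

/-- The value of the optimal constant. -/
theorem kappa_eq (hp : 1 ≤ p) (hb : b ≠ 0) :
    kappa p b = ENNReal.ofReal (Real.exp (gaussEntropy p) / (gaussNorm p * |b|)) := by
  rcases hp.eq_or_lt with rfl | hp1
  · rw [kappa, if_pos rfl, gaussEntropy_one, gaussNorm, if_pos rfl, Real.exp_zero]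
    congr 1
    have := abs_pos.2 hb
    field_simp
  have hp0 : 0 < p - 1 := by linarith
  have hp2 : 0 < p := by linarith
  have hb' := abs_pos.2 hb
  rw [kappa, if_neg hp1.ne', fisherPhi, fisherF_deformedGaussian hp1 hb,
    shannon_deformedGaussian hp1, ENNReal.ofReal_rpow_of_pos (by positivity),
    ← ENNReal.ofReal_mul (by positivity), ENNReal.ofReal_rpow_of_pos (by positivity)]
  congr 1
  rw [Real.mul_rpow (by positivity) (by positivity), ← Real.rpow_mul (by positivity),
    ← Real.exp_mul, div_mul_cancel₀ _ hb, show 1 / (p * b) * b = 1 / p by field_simp,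
    Real.mul_rpow (by positivity) (by positivity), ← Real.rpow_mul (by positivity),
    mul_one_div_cancel hp2.ne', Real.rpow_one, gaussNorm, if_neg hp1.ne']
  -- With m = 1/p*, the powers combine to m^{-1} m^{1-m} = m^{-m}, the inverse of `gaussNorm p`.
  set m := (p - 1) / p with hm
  have hm0 : 0 < m := by positivity
  have h1 : p / (p - 1) = m⁻¹ := by rw [hm, inv_div]
  have h2 : 1 / p = 1 - m := by rw [hm]; field_simp; ring
  rw [h1, h2, Real.rpow_sub hm0, Real.rpow_one]
  have := Real.rpow_pos_of_pos hm0 m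
  field_simp

end Deformed

/-! ### Absolute continuity and boundary behaviour of `g ^ b` -/

lemma _root_.AbsolutelyContinuousOnInterval.lipschitzOnWith_comp {f h : ℝ → ℝ} {a b : ℝ}
    {K : NNReal} {S : Set ℝ} (hh : LipschitzOnWith K h S)
    (hf : AbsolutelyContinuousOnInterval f a b) (hS : MapsTo f (uIcc a b) S) :
    AbsolutelyContinuousOnInterval (fun x => h (f x)) a b := by
  rw [absolutelyContinuousOnInterval_iff] at hf ⊢
  intro ε hε
  obtain ⟨δ, hδ, H⟩ := hf (ε / (K + 1)) (by positivity)
  refine ⟨δ, hδ, fun E hE hlt => ?_⟩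
  have h1 := H E hE hlt
  rw [lt_div_iff₀ (by positivity)] at h1
  refine lt_of_le_of_lt ?_ h1
  rw [mul_comm, Finset.mul_sum]
  refine Finset.sum_le_sum fun i hi => ?_
  have h2 := hh.dist_le_mul _ (hS (hE.1 i hi).1) _ (hS (hE.1 i hi).2)
  refine h2.trans (mul_le_mul_of_nonneg_right ?_ dist_nonneg)
  linarith

/-- The a.e. derivative of `g ^ b`. -/
noncomputable def derivRpow (b : ℝ) (g : ℝ → ℝ) (s : ℝ) : ℝ := b * g s ^ (b - 1) * deriv g s

section Core

variable {g : ℝ → ℝ} {I : Set ℝ} {b p : ℝ}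

/-- On a compact subinterval of `I` the density stays between two positive constants, where the
power is Lipschitz. Hence `g ^ b` is absolutely continuous there and the fundamental theorem of
calculus applies. -/
lemma rpow_sub_rpow_eq_integral (hg : IsIntervalDensity g I)
    (hAC : ∀ a c : ℝ, uIcc a c ⊆ I → AbsolutelyContinuousOnInterval g a c)
    {s t : ℝ} (hs : s ∈ I) (ht : t ∈ I) :
    g t ^ b - g s ^ b = ∫ u in s..t, derivRpow b g u := by
  have hsub : uIcc s t ⊆ I := hg.ordConnected.uIcc_subset hs ht
  have hA := hAC s t hsub
  have hcomp : IsCompact (g '' uIcc s t) := isCompact_uIcc.image_of_continuousOn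
    (hg.continuousOn.mono hsub)
  have hne : (g '' uIcc s t).Nonempty := (nonempty_uIcc).image g
  obtain ⟨⟨x, hx, hxm⟩, hmin⟩ := hcomp.isLeast_sInf hne
  obtain ⟨⟨y, hy, hyM⟩, hmax⟩ := hcomp.isGreatest_sSup hne
  set m := sInf (g '' uIcc s t)
  set M := sSup (g '' uIcc s t)
  have hm : 0 < m := hxm ▸ hg.pos x (hsub hx)
  obtain ⟨K, hK⟩ : ∃ K, LipschitzOnWith K (fun w : ℝ => w ^ b) (Icc m M) := by
    refine ContDiffOn.exists_lipschitzOnWith (n := 1) (fun w hw => ?_) (by decide)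
      (convex_Icc _ _) isCompact_Icc
    exact (Real.contDiffAt_rpow_const_of_ne (hm.trans_le hw.1).ne').contDiffWithinAt
  have hR := hA.lipschitzOnWith_comp hK fun u hu =>
    ⟨hmin (mem_image_of_mem g hu), hmax (mem_image_of_mem g hu)⟩
  rw [← hR.integral_deriv_eq_sub]
  refine intervalIntegral.integral_congr_ae ?_
  filter_upwards [hA.ae_differentiableAt] with u hu hu'
  have hu1 := uIoc_subset_uIcc hu'
  rw [((hu hu1).hasDerivAt.rpow_const (Or.inl (hg.pos u (hsub hu1)).ne')).deriv, derivRpow]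
  ring

/-- If the remaining variation were smaller than `g s ^ b`, then `g ^ b` would stay above some ε > 0
and have a positive limit at the right end. `hlim` excludes this at a finite end, integrability of
`g` at infinity. -/
lemma lintegral_enorm_derivRpow_lower_right (hg : IsIntervalDensity g I) {V : ℝ → ℝ}
    (hb : b ≠ 0) (hV : IntegrableOn V I)
    (hR : ∀ s ∈ I, ∀ t ∈ I, g t ^ b - g s ^ b = ∫ u in s..t, V u)
    (hlim : ∀ e ∈ frontier I, ∀ L : ℝ, 0 < L → ¬ Tendsto g (𝓝[I] e) (𝓝 L))
    {s : ℝ} (hs : s ∈ I) :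
    ENNReal.ofReal (g s ^ b) ≤ ∫⁻ u in I ∩ Ioi s, ‖V u‖ₑ := by
  have hmI := hg.isOpen.measurableSet
  have hVs : IntegrableOn V (I ∩ Ioi s) := hV.mono_set inter_subset_left
  rw [← ofReal_integral_norm_eq_lintegral_enorm hVs]
  refine ENNReal.ofReal_le_ofReal ?_
  by_contra hcon
  rw [not_le] at hcon
  set A := ∫ u in I ∩ Ioi s, ‖V u‖
  set ε := g s ^ b - A with hεdef
  have hε : 0 < ε := by linarith
  set V0 := I.indicator V with hV0
  have hV0i : Integrable V0 := hV.integrable_indicator hmI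
  -- `P` continues `g ^ b` beyond the end of `I`, so the limit at a finite endpoint is just a value
  -- of `P`.
  set P : ℝ → ℝ := fun x => g s ^ b + ∫ u in s..x, V0 u with hP
  have hPc : Continuous P := continuous_const.add (intervalIntegral.continuous_primitive
    (fun _ _ => hV0i.intervalIntegrable) s)
  have hPR : ∀ x ∈ I, g x ^ b = P x := fun x hx => by
    have h1 : ∫ u in s..x, V0 u = ∫ u in s..x, V u :=
      intervalIntegral.integral_congr fun u hu =>
        indicator_of_mem (hg.ordConnected.uIcc_subset hs hx hu) V
    simp only [hP]
    rw [h1, ← hR s hs x hx]; ring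
  have hgP : ∀ x ∈ I, g x = P x ^ (1 / b) := fun x hx => by
    rw [← hPR x hx, ← Real.rpow_mul (hg.pos x hx).le, mul_one_div_cancel hb, Real.rpow_one]
  have hlow : ∀ x, s ≤ x → ε ≤ P x := fun x hx => by
    have h1 : |∫ u in s..x, V0 u| ≤ A := by
      rw [intervalIntegral.integral_of_le hx]
      calc |∫ u in Ioc s x, V0 u| ≤ ∫ u in Ioc s x, ‖V0 u‖ := by
            rw [← Real.norm_eq_abs]; exact norm_integral_le_integral_norm _
        _ ≤ ∫ u in Ioi s, ‖V0 u‖ := setIntegral_mono_set hV0i.norm.integrableOn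
            (Eventually.of_forall fun _ => norm_nonneg _)
            (Eventually.of_forall fun _ h => h.1)
        _ = A := by
            simp only [hV0, norm_indicator_eq_indicator_norm]
            rw [setIntegral_indicator hmI, inter_comm]
    have := neg_abs_le (∫ u in s..x, V0 u)
    simp only [hP]
    linarith
  by_cases hbdd : BddAbove I
  · set e := sSup I
    have hlub : IsLUB I e := isLUB_csSup ⟨s, hs⟩ hbdd
    have heI : e ∉ I := fun he => by
      obtain ⟨y, hy, hey⟩ := hg.exists_gt he
      exact absurd (hlub.1 hy) (not_le.2 hey)
    have hecl : e ∈ closure I := hlub.mem_closure ⟨s, hs⟩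
    have hefr : e ∈ frontier I := by rw [hg.isOpen.frontier_eq]; exact ⟨hecl, heI⟩
    have hPe : 0 < P e := hε.trans_le (hlow e (hlub.1 hs))
    refine hlim e hefr (P e ^ (1 / b)) (Real.rpow_pos_of_pos hPe _) ?_
    have h1 : Tendsto (fun x => P x ^ (1 / b)) (𝓝[I] e) (𝓝 (P e ^ (1 / b))) :=
      (hPc.continuousAt.rpow_const (Or.inl hPe.ne')).tendsto.mono_left nhdsWithin_le_nhds
    exact h1.congr' (eventually_mem_nhdsWithin.mono fun x hx => (hgP x hx).symm)
  · have hIoi : Ici s ⊆ I := fun x hx => by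
      obtain ⟨y, hy, hxy⟩ := not_bddAbove_iff.1 hbdd x
      exact hg.ordConnected.out hs hy ⟨hx, hxy.le⟩
    set L := g s ^ b + ∫ u in Ioi s, V0 u
    have hPL : Tendsto P atTop (𝓝 L) := tendsto_const_nhds.add
      (intervalIntegral_tendsto_integral_Ioi s hV0i.integrableOn tendsto_id)
    have hL : 0 < L := hε.trans_le
      (ge_of_tendsto hPL ((eventually_ge_atTop s).mono fun x hx => hlow x hx))
    have hL' : 0 < L ^ (1 / b) := Real.rpow_pos_of_pos hL _
    have h1 : Tendsto (fun x => P x ^ (1 / b)) atTop (𝓝 (L ^ (1 / b))) :=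
      hPL.rpow_const (Or.inl hL.ne')
    obtain ⟨x₀, hx₀⟩ := eventually_atTop.1
      ((h1.eventually (lt_mem_nhds (half_lt_self hL'))).and (eventually_ge_atTop s))
    -- Far out `g` exceeds half its positive limit, so a positive constant would be integrable on a
    -- half-line.
    have h2 : IntegrableOn (fun _ : ℝ => L ^ (1 / b) / 2) (Ioi x₀) := by
      refine Integrable.mono' (hg.integrable.integrableOn (s := Ioi x₀)) (by fun_prop) ?_
      refine (ae_restrict_iff' measurableSet_Ioi).2 (Eventually.of_forall fun x hx => ?_)
      obtain ⟨h3, h4⟩ := hx₀ x (le_of_lt hx)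
      rw [Real.norm_of_nonneg (by positivity), hgP x (hIoi h4)]
      exact h3.le
    rw [integrableOn_const_iff] at h2
    rcases h2 with h2 | h2
    · exact (half_pos hL').ne' (enorm_eq_zero.1 h2)
    · simp at h2

lemma IsIntervalDensity.comp_neg (hg : IsIntervalDensity g I) :
    IsIntervalDensity (fun x => g (-x)) (-I) := by
  refine ⟨hg.isOpen.neg, ⟨fun x hx y hy z hz => ?_⟩, fun x hx => hg.pos _ hx,
    fun x hx => hg.zero _ hx, hg.continuousOn.comp continuous_neg.continuousOn fun x hx => hx, ?_⟩
  · exact hg.ordConnected.out hy hx ⟨neg_le_neg hz.2, neg_le_neg hz.1⟩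
  · rw [integral_neg_eq_self g volume, hg.integral_eq_one]

/-- Reflection x ↦ -x reduces this to the right-hand bound; the derivative of the reflected power is
`-V (-x)`. -/
lemma lintegral_enorm_derivRpow_lower_left (hg : IsIntervalDensity g I) {V : ℝ → ℝ}
    (hb : b ≠ 0) (hV : IntegrableOn V I)
    (hR : ∀ s ∈ I, ∀ t ∈ I, g t ^ b - g s ^ b = ∫ u in s..t, V u)
    (hlim : ∀ e ∈ frontier I, ∀ L : ℝ, 0 < L → ¬ Tendsto g (𝓝[I] e) (𝓝 L))
    {s : ℝ} (hs : s ∈ I) :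
    ENNReal.ofReal (g s ^ b) ≤ ∫⁻ u in I ∩ Iio s, ‖V u‖ₑ := by
  have hneg : MeasurePreserving (fun x : ℝ => -x) := Measure.measurePreserving_neg volume
  have hemb : MeasurableEmbedding (fun x : ℝ => -x) := (Homeomorph.neg ℝ).measurableEmbedding
  have h := lintegral_enorm_derivRpow_lower_right hg.comp_neg (V := fun x => -V (-x)) hb
    ?_ (fun s hs t ht => ?_) (fun e he L hL hT => ?_) (s := -s) (by simpa using hs)
  · simp only [neg_neg, enorm_neg] at h
    refine h.trans_eq ?_
    rw [← hneg.setLIntegral_comp_preimage_emb hemb (fun u => ‖V u‖ₑ) (I ∩ Iio s)]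
    congr 2
    ext x
    simp
  · exact ((hneg.integrableOn_comp_preimage hemb).2 hV).neg
  · rw [hR _ hs _ ht, intervalIntegral.integral_neg, intervalIntegral.integral_comp_neg,
      intervalIntegral.integral_symm]
  · have h1 : -e ∈ frontier I := by
      have : frontier (-I) = -frontier I :=
        ((Homeomorph.neg ℝ).preimage_frontier I).symm
      rw [this] at he
      exact he
    refine hlim (-e) h1 L hL ?_
    have h2 : Tendsto (fun x : ℝ => -x) (𝓝[I] (-e)) (𝓝[-I] e) := by
      refine tendsto_nhdsWithin_iff.2 ⟨?_, ?_⟩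
      · have := (continuous_neg (G := ℝ)).tendsto (-e)
        rw [neg_neg] at this
        exact this.mono_left nhdsWithin_le_nhds
      · exact eventually_mem_nhdsWithin.mono fun x hx => by simpa using hx
    simpa [Function.comp_def] using hT.comp h2

/-- Tonelli's theorem on the region `{(s, u) | s < u}`. -/
lemma lintegral_mul_lintegral_Ioi {μ : Measure ℝ} [SFinite μ] {τ v : ℝ → ℝ≥0∞}
    (hτ : AEMeasurable τ μ) (hv : AEMeasurable v μ) :
    ∫⁻ s, τ s * ∫⁻ u in Ioi s, v u ∂μ ∂μ = ∫⁻ u, v u * ∫⁻ s in Iio u, τ s ∂μ ∂μ := by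
  have h1 : ∀ s, τ s * ∫⁻ u in Ioi s, v u ∂μ
      = ∫⁻ u, {q : ℝ × ℝ | q.1 < q.2}.indicator (fun q => τ q.1 * v q.2) (s, u) ∂μ := fun s => by
    rw [← lintegral_const_mul'' _ hv.restrict, ← lintegral_indicator measurableSet_Ioi]
    rfl
  have h2 : ∀ u, v u * ∫⁻ s in Iio u, τ s ∂μ
      = ∫⁻ s, {q : ℝ × ℝ | q.1 < q.2}.indicator (fun q => τ q.1 * v q.2) (s, u) ∂μ := fun u => by
    rw [← lintegral_const_mul'' _ hτ.restrict, ← lintegral_indicator measurableSet_Iio]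
    refine lintegral_congr fun s => ?_
    by_cases h : s < u <;> simp [indicator, h, mul_comm]
  simp_rw [h1, h2]
  refine lintegral_lintegral_swap ?_
  refine AEMeasurable.indicator ?_ (measurableSet_lt measurable_fst measurable_snd)
  exact (hτ.comp_quasiMeasurePreserving Measure.quasiMeasurePreserving_fst).mul
    (hv.comp_quasiMeasurePreserving Measure.quasiMeasurePreserving_snd)

end Core

/-! ### Integration by parts against a monotone map -/

section Transport

variable {g : ℝ → ℝ} {I : Set ℝ} {T τ : ℝ → ℝ}

/-- By the change of variables formula the integral is the length of `T '' S`. No integrability or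
continuity of `τ` is needed. -/
lemma lintegral_deriv_le_of_strictMonoOn (hT : StrictMonoOn T I)
    (hτ : ∀ s ∈ I, HasDerivAt T (τ s) s) {S : Set ℝ} (hS : MeasurableSet S) (hSI : S ⊆ I)
    {a c : ℝ} (hac : MapsTo T S (Icc a c)) :
    ∫⁻ s in S, ENNReal.ofReal |τ s| ≤ ENNReal.ofReal (c - a) := by
  have h := lintegral_image_eq_lintegral_abs_deriv_mul hS
    (fun x hx => (hτ x (hSI hx)).hasDerivWithinAt) (hT.injOn.mono hSI) 1
  simp only [Pi.one_apply, mul_one, setLIntegral_one] at h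
  rw [← h, ← Real.volume_Icc]
  exact measure_mono hac.image_subset

/-- The one-dimensional integration by parts inequality `∫ R T' ≤ ∫ |T| |R'|` for a function `R`
that vanishes at both ends of the interval. -/
lemma lintegral_mul_deriv_le (hIo : IsOpen I)
    (hT : StrictMonoOn T I) (hτ : ∀ s ∈ I, HasDerivAt T (τ s) s) {s₀ : ℝ} (hs₀ : s₀ ∈ I)
    (hT0 : T s₀ = 0) {R v : ℝ → ℝ≥0∞} (hv : AEMeasurable v (volume.restrict I))
    (hr : ∀ s ∈ I, R s ≤ ∫⁻ u in I ∩ Ioi s, v u) (hl : ∀ s ∈ I, R s ≤ ∫⁻ u in I ∩ Iio s, v u) :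
    ∫⁻ s in I, ENNReal.ofReal |τ s| * R s ≤ ∫⁻ s in I, ENNReal.ofReal |T s| * v s := by
  have hmI := hIo.measurableSet
  have hτm : AEMeasurable (fun s => ENNReal.ofReal |τ s|) (volume.restrict I) := by
    refine (((measurable_deriv T).abs.ennreal_ofReal).aemeasurable).congr ?_
    refine (ae_restrict_iff' hmI).2 (Eventually.of_forall fun s hs => ?_)
    simp only [(hτ s hs).deriv]
  -- Bound `R` by its right tail and exchange the integrals; the inner one is then the increase of
  -- `T` between `s₀` and `u`, at most `T u` because `T s₀ = 0`. The left half is symmetric.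
  have hright : ∫⁻ s in I ∩ Ioi s₀, ENNReal.ofReal |τ s| * R s ≤
      ∫⁻ s in I ∩ Ioi s₀, ENNReal.ofReal |T s| * v s := by
    have hm := hmI.inter (measurableSet_Ioi (a := s₀))
    have hle : volume.restrict (I ∩ Ioi s₀) ≤ volume.restrict I :=
      Measure.restrict_mono inter_subset_left le_rfl
    calc _ ≤ ∫⁻ s in I ∩ Ioi s₀, ENNReal.ofReal |τ s| *
          ∫⁻ u in Ioi s, v u ∂(volume.restrict (I ∩ Ioi s₀)) := by
          refine setLIntegral_mono' hm fun s hs => mul_le_mul_right ((hr s hs.1).trans_eq ?_) _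
          rw [Measure.restrict_restrict measurableSet_Ioi]
          congr 2
          ext u
          simp only [mem_inter_iff, mem_Ioi]
          exact ⟨fun h => ⟨h.2, h.1, lt_trans hs.2 h.2⟩, fun h => ⟨h.2.1, h.1⟩⟩
      _ = ∫⁻ u in I ∩ Ioi s₀, v u * ∫⁻ s in Iio u, ENNReal.ofReal |τ s|
            ∂(volume.restrict (I ∩ Ioi s₀)) :=
          lintegral_mul_lintegral_Ioi (hτm.mono_measure hle) (hv.mono_measure hle)
      _ ≤ _ := by
          refine setLIntegral_mono' hm fun u hu => ?_
          rw [mul_comm]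
          refine mul_le_mul_left ?_ _
          rw [Measure.restrict_restrict measurableSet_Iio]
          refine (lintegral_deriv_le_of_strictMonoOn hT hτ (measurableSet_Iio.inter hm)
            (fun x hx => hx.2.1) (a := 0) (c := T u) fun x hx => ⟨?_, ?_⟩).trans ?_
          · rw [← hT0]; exact (hT hs₀ hx.2.1 hx.2.2).le
          · exact (hT hx.2.1 hu.1 hx.1).le
          · rw [sub_zero]; exact ENNReal.ofReal_le_ofReal (le_abs_self _)
  have hleft : ∫⁻ s in I ∩ Iio s₀, ENNReal.ofReal |τ s| * R s ≤
      ∫⁻ s in I ∩ Iio s₀, ENNReal.ofReal |T s| * v s := by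
    have hm := hmI.inter (measurableSet_Iio (a := s₀))
    have hle : volume.restrict (I ∩ Iio s₀) ≤ volume.restrict I :=
      Measure.restrict_mono inter_subset_left le_rfl
    calc _ ≤ ∫⁻ s in I ∩ Iio s₀, ENNReal.ofReal |τ s| *
          ∫⁻ u in Iio s, v u ∂(volume.restrict (I ∩ Iio s₀)) := by
          refine setLIntegral_mono' hm fun s hs => mul_le_mul_right ((hl s hs.1).trans_eq ?_) _
          rw [Measure.restrict_restrict measurableSet_Iio]
          congr 2
          ext u
          simp only [mem_inter_iff, mem_Iio]
          exact ⟨fun h => ⟨h.2, h.1, lt_trans h.2 hs.2⟩, fun h => ⟨h.2.1, h.1⟩⟩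
      _ = ∫⁻ u in I ∩ Iio s₀, v u * ∫⁻ s in Ioi u, ENNReal.ofReal |τ s|
            ∂(volume.restrict (I ∩ Iio s₀)) :=
          (lintegral_mul_lintegral_Ioi (hv.mono_measure hle) (hτm.mono_measure hle)).symm
      _ ≤ _ := by
          refine setLIntegral_mono' hm fun u hu => ?_
          rw [mul_comm]
          refine mul_le_mul_left ?_ _
          rw [Measure.restrict_restrict measurableSet_Ioi]
          refine (lintegral_deriv_le_of_strictMonoOn hT hτ (measurableSet_Ioi.inter hm)
            (fun x hx => hx.2.1) (a := T u) (c := 0) fun x hx => ⟨?_, ?_⟩).trans ?_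
          · exact (hT hu.1 hx.2.1 hx.1).le
          · rw [← hT0]; exact (hT hx.2.1 hs₀ hx.2.2).le
          · rw [zero_sub]; exact ENNReal.ofReal_le_ofReal (neg_le_abs _)
  have hsplit : ∀ F : ℝ → ℝ≥0∞, ∫⁻ s in I, F s =
      (∫⁻ s in I ∩ Iio s₀, F s) + ∫⁻ s in I ∩ Ioi s₀, F s := fun F => by
    rw [← lintegral_union (hmI.inter measurableSet_Ioi)
      (disjoint_left.2 fun x h1 h2 => lt_asymm (mem_Iio.1 h1.2) (mem_Ioi.1 h2.2)),
      ← inter_union_distrib_left, Iio_union_Ioi]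
    refine setLIntegral_congr ?_
    refine Filter.EventuallyEq.symm ?_
    exact sdiff_null_ae_eq_self (measure_singleton s₀)
  rw [hsplit, hsplit]
  exact add_le_add hleft hright

end Transport

/-! ### Hölder's inequality for the derivative of `g ^ b` -/

section Holder

variable {g : ℝ → ℝ} {I : Set ℝ} {b p : ℝ}

lemma enorm_derivRpow (hg : IsIntervalDensity g I) {s : ℝ} (hs : s ∈ I) :
    ‖derivRpow b g s‖ₑ = ENNReal.ofReal |b| *
      (ENNReal.ofReal |g s ^ (b - 2) * deriv g s| * ENNReal.ofReal (g s)) := by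
  have h0 := hg.pos s hs
  rw [← ENNReal.ofReal_mul (abs_nonneg _), ← ENNReal.ofReal_mul (abs_nonneg _), ← ofReal_norm,
    Real.norm_eq_abs, derivRpow]
  congr 1
  rw [show b - 1 = b - 2 + 1 by ring, Real.rpow_add h0, Real.rpow_one, abs_mul, abs_mul, abs_mul,
    abs_mul, abs_of_pos h0]
  ring

/-- Hölder's inequality with respect to the density `g`. -/
lemma lintegral_mul_enorm_derivRpow_le (hg : IsIntervalDensity g I) (hp : 1 ≤ p) {w : ℝ → ℝ}
    (hw : ContinuousOn w I) (hw0 : ∀ s ∈ I, 0 ≤ w s) {C : ℝ} (hC : 0 < C)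
    (h1 : p = 1 → ∀ s ∈ I, w s ≤ C)
    (h2 : 1 < p → ∫⁻ s in I, ENNReal.ofReal (w s ^ (p / (p - 1)) * g s) ≤
      ENNReal.ofReal (C ^ (p / (p - 1)))) :
    ∫⁻ s in I, ENNReal.ofReal (w s) * ‖derivRpow b g s‖ₑ ≤
      ENNReal.ofReal (C * |b|) * fisherF p b g ^ (1 / p) := by
  have hmI := hg.isOpen.measurableSet
  have hgm : AEMeasurable g (volume.restrict I) := hg.continuousOn.aemeasurable hmI
  have hXm : AEMeasurable (fun s => |g s ^ (b - 2) * deriv g s|) (volume.restrict I) :=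
    ((hgm.pow_const _).mul (measurable_deriv g).aemeasurable).abs
  rw [fisherF, hg.support_eq]
  rcases hp.eq_or_lt with rfl | hp1
  · simp only [Real.rpow_one, div_one, ENNReal.rpow_one]
    refine le_of_le_of_eq ?_ (lintegral_const_mul'' _ (hXm.mul hgm).ennreal_ofReal)
    refine setLIntegral_mono' hmI fun s hs => ?_
    rw [enorm_derivRpow hg hs, ENNReal.ofReal_mul (abs_nonneg _), ENNReal.ofReal_mul hC.le,
      mul_assoc]
    exact mul_le_mul_left (ENNReal.ofReal_le_ofReal (h1 rfl s hs)) _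
  · have hp0 : 0 < p - 1 := by linarith
    have hpp : 0 < p := by linarith
    have hconj : p.HolderConjugate (p / (p - 1)) := Real.HolderConjugate.conjExponent hp1
    set c := p / (p - 1) with hc
    have hc0 : 0 < c := by positivity
    -- The weight is split as g = g^{1/p} g^{1/p*} between the two factors.
    set f₁ : ℝ → ℝ≥0∞ := fun s =>
      ENNReal.ofReal (|g s ^ (b - 2) * deriv g s| * g s ^ (1 / p)) with hf₁
    set f₂ : ℝ → ℝ≥0∞ := fun s => ENNReal.ofReal (w s * g s ^ (1 / c)) with hf₂
    have hf₁m : AEMeasurable f₁ (volume.restrict I) :=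
      (hXm.mul (hgm.pow_const _)).ennreal_ofReal
    have hf₂m : AEMeasurable f₂ (volume.restrict I) :=
      ((hw.aemeasurable hmI).mul (hgm.pow_const _)).ennreal_ofReal
    have hH := ENNReal.lintegral_mul_le_Lp_mul_Lq (volume.restrict I) hconj hf₁m hf₂m
    have e1 : ∫⁻ s in I, f₁ s ^ p =
        ∫⁻ s in I, ENNReal.ofReal (|g s ^ (b - 2) * deriv g s| ^ p * g s) := by
      refine setLIntegral_congr_fun hmI fun s hs => ?_
      have h0 := hg.pos s hs
      simp only [hf₁]
      rw [ENNReal.ofReal_rpow_of_nonneg (by positivity) hpp.le,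
        Real.mul_rpow (abs_nonneg _) (by positivity), ← Real.rpow_mul h0.le,
        one_div_mul_cancel hpp.ne', Real.rpow_one]
    have e2 : ∫⁻ s in I, f₂ s ^ c = ∫⁻ s in I, ENNReal.ofReal (w s ^ c * g s) := by
      refine setLIntegral_congr_fun hmI fun s hs => ?_
      have h0 := hg.pos s hs
      have h3 := hw0 s hs
      simp only [hf₂]
      rw [ENNReal.ofReal_rpow_of_nonneg (by positivity) hc0.le,
        Real.mul_rpow h3 (by positivity), ← Real.rpow_mul h0.le,
        one_div_mul_cancel hc0.ne', Real.rpow_one]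
    have e3 : ∫⁻ s in I, ENNReal.ofReal (w s) * ‖derivRpow b g s‖ₑ =
        ENNReal.ofReal |b| * ∫⁻ s in I, (f₁ * f₂) s := by
      rw [← lintegral_const_mul'' _ (hf₁m.mul hf₂m)]
      refine setLIntegral_congr_fun hmI fun s hs => ?_
      have h0 := hg.pos s hs
      have h3 := hw0 s hs
      simp only [Pi.mul_apply, hf₁, hf₂]
      rw [enorm_derivRpow hg hs, mul_left_comm]
      congr 1
      rw [← ENNReal.ofReal_mul (abs_nonneg _), ← ENNReal.ofReal_mul h3,
        ← ENNReal.ofReal_mul (by positivity)]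
      congr 1
      have h4 : g s ^ (1 / p) * g s ^ (1 / c) = g s := by
        rw [← Real.rpow_add h0, one_div, one_div, hconj.inv_add_inv_eq_one, Real.rpow_one]
      calc _ = w s * (|g s ^ (b - 2) * deriv g s| * (g s ^ (1 / p) * g s ^ (1 / c))) := by rw [h4]
        _ = _ := by ring
    rw [e1, e2] at hH
    rw [e3]
    calc _ ≤ ENNReal.ofReal |b| * ((∫⁻ s in I, ENNReal.ofReal
          (|g s ^ (b - 2) * deriv g s| ^ p * g s)) ^ (1 / p) *
            ENNReal.ofReal (C ^ c) ^ (1 / c)) := by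
          refine mul_le_mul_right (hH.trans ?_) _
          refine mul_le_mul_right ?_ _
          exact ENNReal.rpow_le_rpow (h2 hp1) (by positivity)
      _ = _ := by
          rw [ENNReal.ofReal_rpow_of_nonneg (by positivity) (by positivity),
            ← Real.rpow_mul hC.le, mul_one_div_cancel hc0.ne', Real.rpow_one,
            ENNReal.ofReal_mul hC.le]
          ring

end Holder

/-! ### Jensen's inequality for the logarithm -/

section Jensen

variable {g : ℝ → ℝ} {I : Set ℝ}

/-- Jensen's inequality for the logarithm, with its equality case. -/
lemma integral_mul_log_le (hg : IsIntervalDensity g I) {h : ℝ → ℝ} (hc : ContinuousOn h I)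
    (hpos : ∀ s ∈ I, 0 < h s) (hlog : IntegrableOn (fun s => g s * Real.log (h s)) I) {K : ℝ}
    (hK : 0 < K) (hle : ∫⁻ s in I, ENNReal.ofReal (g s * h s) ≤ ENNReal.ofReal K) :
    ∫ s in I, g s * Real.log (h s) ≤ Real.log K ∧
      (∫ s in I, g s * Real.log (h s) = Real.log K → ∀ s ∈ I, h s = K) := by
  have hmI := hg.isOpen.measurableSet
  have hnn : 0 ≤ᵐ[volume.restrict I] fun s => g s * h s :=
    (ae_restrict_iff' hmI).2 (Eventually.of_forall fun s hs =>
      (mul_pos (hg.pos s hs) (hpos s hs)).le)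
  have hgh : IntegrableOn (fun s => g s * h s) I := by
    refine ⟨(hg.continuousOn.mul hc).aestronglyMeasurable hmI, ?_⟩
    rw [hasFiniteIntegral_iff_ofReal hnn]
    exact hle.trans_lt ENNReal.ofReal_lt_top
  have hint : ∫ s in I, g s * h s ≤ K := by
    rw [integral_eq_lintegral_of_nonneg_ae hnn hgh.1]
    exact ENNReal.toReal_le_of_le_ofReal hK.le hle
  -- The defect in log t ≤ t - 1 at t = h/K, weighted by `g`: its nonnegative integral gives the
  -- inequality, and its vanishing gives the equality case.
  set φ : ℝ → ℝ := fun s => g s * (h s / K - 1 - Real.log (h s / K)) with hφ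
  have hφ0 : ∀ s ∈ I, 0 ≤ φ s := fun s hs => by
    have := Real.log_le_sub_one_of_pos (div_pos (hpos s hs) hK)
    exact mul_nonneg (hg.pos s hs).le (by linarith)
  have hφe : EqOn φ (fun s => g s * h s * K⁻¹ - g s - g s * Real.log (h s) + g s * Real.log K) I :=
    fun s hs => by
      simp only [hφ]
      rw [Real.log_div (hpos s hs).ne' hK.ne']
      ring
  have i1 := hgh.mul_const K⁻¹
  have i2 : IntegrableOn g I := hg.integrable.integrableOn
  have i3 := i2.mul_const (Real.log K)
  have i4 : IntegrableOn (fun s => g s * h s * K⁻¹ - g s) I := Integrable.sub i1 i2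
  have i5 : IntegrableOn (fun s => g s * h s * K⁻¹ - g s - g s * Real.log (h s)) I :=
    Integrable.sub i4 hlog
  have i6 : IntegrableOn
      (fun s => g s * h s * K⁻¹ - g s - g s * Real.log (h s) + g s * Real.log K) I :=
    Integrable.add i5 i3
  have hφi : IntegrableOn φ I := i6.congr_fun (fun s hs => (hφe hs).symm) hmI
  have hφint : ∫ s in I, φ s =
      (∫ s in I, g s * h s) * K⁻¹ - 1 - (∫ s in I, g s * Real.log (h s)) + Real.log K := by
    rw [setIntegral_congr_fun hmI hφe, integral_add i5 i3, integral_sub i4 hlog, integral_sub i1 i2, integral_mul_const, integral_mul_const,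
      hg.setIntegral_eq_one, one_mul]
  have hφn : 0 ≤ ∫ s in I, φ s := setIntegral_nonneg hmI hφ0
  have hdiv : (∫ s in I, g s * h s) * K⁻¹ ≤ 1 := by
    rw [← div_eq_mul_inv, div_le_one hK]; exact hint
  refine ⟨by linarith, fun heq s hs => ?_⟩
  have hz : ∫ s in I, φ s = 0 := by linarith
  have hae : φ =ᵐ[volume.restrict I] 0 :=
    (setIntegral_eq_zero_iff_of_nonneg_ae
      ((ae_restrict_iff' hmI).2 (Eventually.of_forall hφ0)) hφi).1 hz
  -- Continuity turns vanishing almost everywhere into vanishing on all of the open set `I`.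
  have hφc : ContinuousOn φ I := by
    have hd := hc.div_const K
    exact hg.continuousOn.mul ((hd.sub continuousOn_const).sub
      (hd.log fun s hs => (div_pos (hpos s hs) hK).ne'))
  have hs0 : φ s = 0 :=
    Measure.eqOn_open_of_ae_eq hae hg.isOpen hφc continuousOn_const hs
  by_contra hne
  have hlt := Real.log_lt_sub_one_of_pos (div_pos (hpos s hs) hK)
    (fun h1 => hne (by rwa [div_eq_one_iff_eq hK.ne'] at h1))
  have := mul_pos (hg.pos s hs) (show 0 < h s / K - 1 - Real.log (h s / K) by linarith)
  exact this.ne' hs0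

end Jensen

/-! ### The generalized Stam inequality -/

section Stam

variable {g : ℝ → ℝ} {I : Set ℝ} {b p : ℝ}

lemma gaussNorm_rpow (hp : 1 < p) : gaussNorm p ^ (p / (p - 1)) = (p - 1) / p := by
  have hp0 : 0 < p - 1 := by linarith
  have hpp : 0 < p := by linarith
  rw [gaussNorm, if_neg hp.ne', ← Real.rpow_mul (by positivity),
    show (p - 1) / p * (p / (p - 1)) = 1 by field_simp, Real.rpow_one]

/-- The generalized Stam inequality for a locally absolutely continuous density, with its equality
case in terms of the transport onto the stretched Gaussian. -/
theorem stam (hg : IsIntervalDensity g I) (hp : 1 ≤ p) (hb : b ≠ 0)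
    (hAC : ∀ a c : ℝ, uIcc a c ⊆ I → AbsolutelyContinuousOnInterval g a c)
    (hlim : ∀ e ∈ frontier I, ∀ L : ℝ, 0 < L → ¬ Tendsto g (𝓝[I] e) (𝓝 L))
    (hlog : IntegrableOn (fun s => g s * Real.log (g s)) I) :
    kappa p b ≤ fisherF p b g ^ (1 / p) * ENNReal.ofReal (Real.exp (b * shannon g)) ∧
    (fisherF p b g ^ (1 / p) * ENNReal.ofReal (Real.exp (b * shannon g)) = kappa p b →
      ∃ T : ℝ → ℝ, T '' I = gaussSupport p ∧
        (∀ s ∈ I, HasDerivAt T (g s / stretchedGaussian p (T s)) s) ∧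
        ∃ K : ℝ, 0 < K ∧ ∀ s ∈ I, g s ^ b = K * stretchedGaussian p (T s)) := by
  have hmI := hg.isOpen.measurableSet
  have hpp : 0 < p := by linarith
  have hN := gaussNorm_pos hp
  have hb' := abs_pos.2 hb
  rw [kappa_eq hp hb]
  set G := stretchedGaussian p with hGdef
  have hG : IsIntervalDensity G (gaussSupport p) := isIntervalDensity_stretchedGaussian hp
  obtain ⟨T, hTm, hTI, hTd⟩ := exists_transport hg hG
  -- When the Fisher information is infinite, the product is infinite while the constant is finite,
  -- so equality cannot occur.
  rcases eq_or_ne (fisherF p b g) ∞ with hFtop | hFtop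
  · have h1 : fisherF p b g ^ (1 / p) * ENNReal.ofReal (Real.exp (b * shannon g)) = ∞ := by
      rw [hFtop, ENNReal.top_rpow_of_pos (by positivity), ENNReal.top_mul]
      exact (ENNReal.ofReal_pos.2 (Real.exp_pos _)).ne'
    rw [h1]
    exact ⟨le_top, fun h => (ENNReal.ofReal_ne_top h.symm).elim⟩
  have hTJ : ∀ s ∈ I, T s ∈ gaussSupport p := fun s hs => hTI ▸ mem_image_of_mem T hs
  have hGT : ∀ s ∈ I, 0 < G (T s) := fun s hs => hG.pos _ (hTJ s hs)
  have hTc : ContinuousOn T I := fun s hs => (hTd s hs).continuousAt.continuousWithinAt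
  have hτ0 : ∀ s ∈ I, 0 < g s / G (T s) := fun s hs => div_pos (hg.pos s hs) (hGT s hs)
  have hTd' : ∀ s ∈ I, HasDerivWithinAt T (g s / G (T s)) I s :=
    fun s hs => (hTd s hs).hasDerivWithinAt
  have hlogG := integrableOn_stretchedGaussian_mul_log hp
  have hkey : ∀ s ∈ I, |g s / G (T s)| * (G (T s) * Real.log (G (T s))) =
      g s * Real.log (G (T s)) := fun s hs => by
    have := hGT s hs
    rw [abs_of_pos (hτ0 s hs)]; field_simp
  have hlogGT : IntegrableOn (fun s => g s * Real.log (G (T s))) I := by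
    rw [← hTI, integrableOn_image_iff_integrableOn_abs_deriv_smul hmI hTd' hTm.injOn] at hlogG
    exact hlogG.congr_fun hkey hmI
  have hEint : ∫ s in I, g s * Real.log (G (T s)) = -gaussEntropy p := by
    rw [gaussEntropy, neg_neg, ← hTI,
      integral_image_eq_integral_abs_deriv_smul hmI hTd' hTm.injOn]
    exact (setIntegral_congr_fun hmI hkey).symm
  -- the weight `|T|`
  have hmain : ∫⁻ s in I, ENNReal.ofReal |T s| * ‖derivRpow b g s‖ₑ ≤
      ENNReal.ofReal (gaussNorm p * |b|) * fisherF p b g ^ (1 / p) := by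
    refine lintegral_mul_enorm_derivRpow_le hg hp hTc.abs (fun s _ => abs_nonneg _) hN ?_ ?_
    · rintro rfl s hs
      have := hTJ s hs
      rw [gaussSupport, if_pos rfl] at this
      rw [gaussNorm, if_pos rfl, abs_le]
      exact ⟨by linarith [this.1], this.2.le⟩
    · intro hp1
      have hpow : ∫⁻ y in gaussSupport p, ENNReal.ofReal (|y| ^ (p / (p - 1)) * G y) =
          ENNReal.ofReal (gaussNorm p ^ (p / (p - 1))) := by
        rw [gaussNorm_rpow hp1, gaussSupport, if_neg hp1.ne', setLIntegral_univ,
          ← ofReal_integral_eq_lintegral_ofReal (integrable_abs_rpow_mul_stretchedGaussian hp1)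
            (Eventually.of_forall fun y => mul_nonneg (by positivity) (hG.nonneg y)),
          integral_abs_rpow_mul_stretchedGaussian hp1]
      rw [← hpow, ← hTI, lintegral_image_eq_lintegral_abs_deriv_mul hmI hTd' hTm.injOn]
      refine (setLIntegral_congr_fun hmI fun s hs => ?_).le
      have := hGT s hs
      rw [← ENNReal.ofReal_mul (abs_nonneg _), abs_of_pos (hτ0 s hs)]
      congr 1
      field_simp
  -- integrability of the derivative
  have hVint : IntegrableOn (derivRpow b g) I := by
    refine ⟨?_, ?_⟩
    · have hgm : AEMeasurable g (volume.restrict I) := hg.continuousOn.aemeasurable hmI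
      exact (((hgm.pow_const _).const_mul _).mul
        (measurable_deriv g).aemeasurable).aestronglyMeasurable
    -- Hölder with the constant weight 1, whose norm for the probability density `g` is at most 1.
    · have h1 := lintegral_mul_enorm_derivRpow_le (b := b) hg hp (w := fun _ => 1) continuousOn_const
        (fun _ _ => zero_le_one) one_pos (fun _ _ _ => le_rfl) (fun hp1 => ?_)
      · simp only [ENNReal.ofReal_one, one_mul] at h1
        exact h1.trans_lt (ENNReal.mul_lt_top ENNReal.ofReal_lt_top
          (ENNReal.rpow_lt_top_of_nonneg (by positivity) hFtop))
      · simp only [Real.one_rpow, one_mul]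
        rw [← ofReal_integral_eq_lintegral_ofReal hg.integrable.integrableOn
          (Eventually.of_forall hg.nonneg), hg.setIntegral_eq_one]
  have hR : ∀ s ∈ I, ∀ t ∈ I, g t ^ b - g s ^ b = ∫ u in s..t, derivRpow b g u :=
    fun s hs t ht => rpow_sub_rpow_eq_integral hg hAC hs ht
  obtain ⟨s₀, hs₀, hTs₀⟩ : (0 : ℝ) ∈ T '' I := hTI ▸ zero_mem_gaussSupport
  have hparts := lintegral_mul_deriv_le hg.isOpen hTm hTd hs₀ hTs₀
    (R := fun s => ENNReal.ofReal (g s ^ b)) hVint.1.enorm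
    (fun s hs => lintegral_enorm_derivRpow_lower_right hg hb hVint hR hlim hs)
    (fun s hs => lintegral_enorm_derivRpow_lower_left hg hb hVint hR hlim hs)
  set Φ := (fisherF p b g ^ (1 / p)).toReal with hΦ
  have hΦtop : fisherF p b g ^ (1 / p) ≠ ∞ := ENNReal.rpow_ne_top_of_nonneg (by positivity) hFtop
  have hΦe : fisherF p b g ^ (1 / p) = ENNReal.ofReal Φ := (ENNReal.ofReal_toReal hΦtop).symm
  set h : ℝ → ℝ := fun s => g s ^ b / G (T s) with hh
  have hRpos : ∀ s ∈ I, 0 < g s ^ b := fun s hs => Real.rpow_pos_of_pos (hg.pos s hs) _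
  have hhpos : ∀ s ∈ I, 0 < h s := fun s hs => div_pos (hRpos s hs) (hGT s hs)
  -- Here g h = g^b · g/G(T) = g^b T', the quantity controlled by integration by parts.
  have hbound : ∫⁻ s in I, ENNReal.ofReal (g s * h s) ≤
      ENNReal.ofReal (gaussNorm p * |b| * Φ) := by
    rw [ENNReal.ofReal_mul (by positivity), ← hΦe]
    refine le_trans (le_of_eq ?_) (hparts.trans hmain)
    refine setLIntegral_congr_fun hmI fun s hs => ?_
    simp only [hh]
    rw [← ENNReal.ofReal_mul (abs_nonneg _), abs_of_pos (hτ0 s hs)]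
    congr 1
    ring
  have hhc : ContinuousOn h I :=
    (hg.continuousOn.rpow_const fun s hs => Or.inl (hg.pos s hs).ne').div
      (hG.continuousOn.comp hTc hTJ) fun s hs => (hGT s hs).ne'
  -- Otherwise the positive function `g * h` would vanish almost everywhere on the nonempty open set
  -- `I`.
  have hΦ0 : 0 < Φ := by
    refine lt_of_le_of_ne ENNReal.toReal_nonneg fun hz => ?_
    rw [← hz, mul_zero, ENNReal.ofReal_zero, nonpos_iff_eq_zero, lintegral_eq_zero_iff'
      (f := fun s => ENNReal.ofReal (g s * h s))
      ((ContinuousOn.aemeasurable (hg.continuousOn.mul hhc) hmI).ennreal_ofReal),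
      Filter.EventuallyEq, ae_restrict_iff' hmI] at hbound
    have hnull : volume I = 0 := measure_eq_zero_iff_ae_notMem.2 (hbound.mono fun s h1 hs =>
      (ENNReal.ofReal_pos.2 (mul_pos (hg.pos s hs) (hhpos s hs))).ne' (h1 hs))
    exact hg.nonempty.ne_empty (hg.isOpen.measure_eq_zero_iff volume |>.1 hnull)
  have hK : 0 < gaussNorm p * |b| * Φ := by positivity
  have hlogh : EqOn (fun s => g s * Real.log (h s))
      (fun s => b * (g s * Real.log (g s)) - g s * Real.log (G (T s))) I := fun s hs => by
    simp only [hh]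
    rw [Real.log_div (hRpos s hs).ne' (hGT s hs).ne', Real.log_rpow (hg.pos s hs)]
    ring
  have hloghi : IntegrableOn (fun s => g s * Real.log (h s)) I := by
    have h1 : IntegrableOn (fun s => b * (g s * Real.log (g s)) - g s * Real.log (G (T s))) I :=
      Integrable.sub (hlog.const_mul b) hlogGT
    exact h1.congr_fun hlogh.symm hmI
  have hlogint : ∫ s in I, g s * Real.log (h s) = gaussEntropy p - b * shannon g := by
    rw [setIntegral_congr_fun hmI hlogh, integral_sub (hlog.const_mul b) hlogGT,
      integral_const_mul, hEint, shannon, hg.support_eq]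
    ring
  obtain ⟨hJ, hJe⟩ := integral_mul_log_le hg hhc hhpos hloghi hK hbound
  rw [hlogint] at hJ hJe
  have hprod : fisherF p b g ^ (1 / p) * ENNReal.ofReal (Real.exp (b * shannon g)) =
      ENNReal.ofReal (Φ * Real.exp (b * shannon g)) := by
    rw [hΦe, ← ENNReal.ofReal_mul hΦ0.le]
  rw [hprod]
  constructor
  · refine ENNReal.ofReal_le_ofReal ?_
    rw [div_le_iff₀ (by positivity)]
    have h1 := Real.exp_le_exp.2 hJ
    rw [Real.exp_log hK, Real.exp_sub, div_le_iff₀ (Real.exp_pos _)] at h1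
    linarith
  · intro heq
    rw [ENNReal.ofReal_eq_ofReal_iff (by positivity) (by positivity),
      eq_div_iff (by positivity)] at heq
    refine ⟨T, hTI, hTd, _, hK, fun s hs => ?_⟩
    have h1 := hJe ?_ s hs
    · rw [← h1]
      exact (div_mul_cancel₀ _ (hGT s hs).ne').symm
    · have h2 : Real.exp (gaussEntropy p) =
          gaussNorm p * |b| * Φ * Real.exp (b * shannon g) := by linarith
      rw [← Real.log_exp (gaussEntropy p), h2, Real.log_mul hK.ne' (Real.exp_pos _).ne',
        Real.log_exp]
      ring

end Stam

/-! ### The down transform: entropy and Fisher information -/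

lemma isOpen_interval (xi : ℝ) (xf : EReal) : IsOpen (interval xi xf) :=
  isOpen_Ioi.inter (isOpen_Iio.preimage continuous_coe_real_ereal)

lemma ordConnected_interval (xi : ℝ) (xf : EReal) : (interval xi xf).OrdConnected :=
  ⟨fun _ hx _ hy _ hz => ⟨lt_of_lt_of_le hx.1 hz.1,
    lt_of_le_of_lt (EReal.coe_le_coe_iff.2 hz.2) hy.2⟩⟩

namespace IsDecreasingDensity

variable {f : ℝ → ℝ} {xi : ℝ} {xf : EReal} {α b p : ℝ}

lemma support_eq (hf : IsDecreasingDensity f xi xf) : Function.support f = interval xi xf := by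
  ext x
  by_cases hx : x ∈ interval xi xf
  · simp [hx, (hf.pos x hx).ne']
  · simp [hx, hf.zero x hx]

lemma isIntervalDensity (hf : IsDecreasingDensity f xi xf) :
    IsIntervalDensity f (interval xi xf) :=
  ⟨isOpen_interval _ _, ordConnected_interval _ _, hf.pos, hf.zero,
    fun x hx => (hf.differentiable x hx).continuousAt.continuousWithinAt, hf.integral_eq_one⟩

/-- The logarithm at α = 2 is the case that makes this derivative formula uniform in α. Since `deriv
f` is negative, the new variable is increasing. -/
lemma hasDerivAt_downVar (hf : IsDecreasingDensity f xi xf) (α : ℝ) {x : ℝ}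
    (hx : x ∈ interval xi xf) :
    HasDerivAt (downVar α f) (f x ^ (1 - α) * |deriv f x|) x := by
  have h0 := hf.pos x hx
  have hd := (hf.differentiable x hx).hasDerivAt
  rw [abs_of_neg (hf.deriv_neg x hx)]
  by_cases hα : α = 2
  · have h1 : downVar α f = fun y => -Real.log (f y) := by funext y; simp [downVar, hα]
    rw [h1, hα]
    refine (hd.log h0.ne').neg.congr_deriv ?_
    rw [show (1 : ℝ) - 2 = -1 by norm_num, Real.rpow_neg_one]
    ring
  · have h1 : downVar α f = fun y => f y ^ (2 - α) / (α - 2) := by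
      funext y; simp [downVar, hα]
    have h2 : α - 2 ≠ 0 := sub_ne_zero.2 hα
    rw [h1]
    refine ((hd.rpow_const (Or.inl h0.ne')).div_const _).congr_deriv ?_
    rw [show 2 - α - 1 = 1 - α by ring]
    field_simp
    ring

lemma deriv_downVar_pos (hf : IsDecreasingDensity f xi xf) (α : ℝ) :
    ∀ x ∈ interval xi xf, 0 < f x ^ (1 - α) * |deriv f x| := fun x hx =>
  mul_pos (Real.rpow_pos_of_pos (hf.pos x hx) _) (abs_pos.2 (hf.deriv_neg x hx).ne)

lemma strictMonoOn_downVar (hf : IsDecreasingDensity f xi xf) (α : ℝ) :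
    StrictMonoOn (downVar α f) (interval xi xf) :=
  strictMonoOn_of_hasDerivAt_pos (ordConnected_interval _ _)
    (fun _ hx => hf.hasDerivAt_downVar α hx) (hf.deriv_downVar_pos α)

lemma continuousOn_downVar (hf : IsDecreasingDensity f xi xf) (α : ℝ) :
    ContinuousOn (downVar α f) (interval xi xf) :=
  fun _ hx => (hf.hasDerivAt_downVar α hx).continuousAt.continuousWithinAt

lemma downSupport_eq (hf : IsDecreasingDensity f xi xf) (α : ℝ) :
    downSupport α f = downVar α f '' interval xi xf := by
  rw [downSupport, hf.support_eq]

lemma isOpen_downSupport (hf : IsDecreasingDensity f xi xf) (α : ℝ) : IsOpen (downSupport α f) := by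
  rw [hf.downSupport_eq]
  exact isOpen_image_of_strictMonoOn (isOpen_interval _ _) (ordConnected_interval _ _)
    (hf.strictMonoOn_downVar α) (hf.continuousOn_downVar α)

lemma down_downVar (hf : IsDecreasingDensity f xi xf) (α : ℝ) {x : ℝ}
    (hx : x ∈ interval xi xf) :
    down α f (downVar α f x) = f x ^ α * |deriv f x|⁻¹ := by
  have h1 : downVar α f x ∈ downSupport α f := by
    rw [hf.downSupport_eq]; exact mem_image_of_mem _ hx
  rw [down, if_pos h1, hf.support_eq, (hf.strictMonoOn_downVar α).injOn.leftInvOn_invFunOn hx]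

lemma down_of_notMem {s : ℝ} (hs : s ∉ downSupport α f) : down α f s = 0 := by
  rw [down, if_neg hs]

/-- Conservation of mass, s'(x) g(s(x)) = f(x), which drives the normalization, the entropy formula
and the inversion. -/
lemma deriv_downVar_mul_down (hf : IsDecreasingDensity f xi xf) (α : ℝ) {x : ℝ}
    (hx : x ∈ interval xi xf) :
    f x ^ (1 - α) * |deriv f x| * down α f (downVar α f x) = f x := by
  have h0 := hf.pos x hx
  have h1 := abs_pos.2 (hf.deriv_neg x hx).ne
  rw [hf.down_downVar α hx]
  calc _ = f x ^ (1 - α) * f x ^ α * (|deriv f x| * |deriv f x|⁻¹) := by ring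
    _ = f x := by rw [← Real.rpow_add h0, sub_add_cancel, Real.rpow_one, mul_inv_cancel₀ h1.ne',
        mul_one]

lemma isIntervalDensity_down (hf : IsDecreasingDensity f xi xf)
    (hc : ContinuousOn (down α f) (downSupport α f)) :
    IsIntervalDensity (down α f) (downSupport α f) := by
  refine ⟨hf.isOpen_downSupport α, ?_, fun s hs => ?_, fun s hs => down_of_notMem hs, hc, ?_⟩
  · rw [hf.downSupport_eq]
    exact ordConnected_image (ordConnected_interval _ _) (hf.continuousOn_downVar α)
  · rw [hf.downSupport_eq] at hs
    obtain ⟨x, hx, rfl⟩ := hs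
    rw [hf.down_downVar α hx]
    exact mul_pos (Real.rpow_pos_of_pos (hf.pos x hx) _)
      (inv_pos.2 (abs_pos.2 (hf.deriv_neg x hx).ne))
  · rw [← setIntegral_eq_integral_of_forall_compl_eq_zero (s := downSupport α f)
      (fun s hs => down_of_notMem hs), hf.downSupport_eq,
      integral_image_eq_integral_abs_deriv_smul (isOpen_interval _ _).measurableSet
        (fun x hx => (hf.hasDerivAt_downVar α hx).hasDerivWithinAt)
        (hf.strictMonoOn_downVar α).injOn]
    refine Eq.trans ?_ hf.isIntervalDensity.setIntegral_eq_one
    refine setIntegral_congr_fun (isOpen_interval _ _).measurableSet fun x hx => ?_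
    simp only [smul_eq_mul]
    rw [abs_of_pos (hf.deriv_downVar_pos α x hx), hf.deriv_downVar_mul_down α hx]

lemma down_mul_log (hf : IsDecreasingDensity f xi xf) (α : ℝ) :
    EqOn (fun x => |(f x ^ (1 - α) * |deriv f x|)| •
        (down α f (downVar α f x) * Real.log (down α f (downVar α f x))))
      (fun x => α * (f x * Real.log (f x)) - f x * Real.log |deriv f x|) (interval xi xf) :=
  fun x hx => by
    have h0 := hf.pos x hx
    have h1 := abs_pos.2 (hf.deriv_neg x hx).ne
    simp only [smul_eq_mul]
    rw [abs_of_pos (hf.deriv_downVar_pos α x hx), ← mul_assoc, hf.deriv_downVar_mul_down α hx,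
      hf.down_downVar α hx, Real.log_mul (Real.rpow_pos_of_pos h0 _).ne' (inv_pos.2 h1).ne',
      Real.log_rpow h0, Real.log_inv]
    ring

lemma integrableOn_down_mul_log (hf : IsDecreasingDensity f xi xf) (α : ℝ)
    (hS : IntegrableOn (fun x => f x * Real.log (f x)) (Function.support f))
    (hL : IntegrableOn (fun x => f x * Real.log |deriv f x|) (Function.support f)) :
    IntegrableOn (fun s => down α f s * Real.log (down α f s)) (downSupport α f) := by
  have hm := (isOpen_interval xi xf).measurableSet
  rw [hf.support_eq] at hS hL
  rw [hf.downSupport_eq, integrableOn_image_iff_integrableOn_abs_deriv_smul hm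
    (fun x hx => (hf.hasDerivAt_downVar α hx).hasDerivWithinAt) (hf.strictMonoOn_downVar α).injOn]
  have h1 : IntegrableOn (fun x => α * (f x * Real.log (f x)) - f x * Real.log |deriv f x|)
      (interval xi xf) := Integrable.sub (hS.const_mul α) hL
  exact h1.congr_fun (hf.down_mul_log α).symm hm

lemma shannon_down (hf : IsDecreasingDensity f xi xf)
    (hg : IsIntervalDensity (down α f) (downSupport α f))
    (hS : IntegrableOn (fun x => f x * Real.log (f x)) (Function.support f))
    (hL : IntegrableOn (fun x => f x * Real.log |deriv f x|) (Function.support f)) :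
    shannon (down α f) = α * shannon f + meanLogDeriv f := by
  have hm := (isOpen_interval xi xf).measurableSet
  rw [shannon, hg.support_eq, shannon, meanLogDeriv]
  rw [hf.support_eq] at hS hL ⊢
  rw [hf.downSupport_eq, integral_image_eq_integral_abs_deriv_smul hm
    (fun x hx => (hf.hasDerivAt_downVar α hx).hasDerivWithinAt) (hf.strictMonoOn_downVar α).injOn,
    setIntegral_congr_fun hm (hf.down_mul_log α), integral_sub (hS.const_mul α) hL,
    integral_const_mul]
  ring

/-- Each point has a compact interval neighbourhood on which almost everywhere differentiability is
known, and a locally null set is null. -/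
lemma ae_differentiableAt_of_locally_absolutelyContinuous {g : ℝ → ℝ} {I : Set ℝ} (hI : IsOpen I)
    (hAC : ∀ a c : ℝ, uIcc a c ⊆ I → AbsolutelyContinuousOnInterval g a c) :
    volume {s | s ∈ I ∧ ¬ DifferentiableAt ℝ g s} = 0 := by
  refine measure_null_of_locally_null _ fun s hs => ?_
  obtain ⟨ε, hε, hb⟩ := Metric.isOpen_iff.1 hI s hs.1
  have hsub : uIcc (s - ε / 2) (s + ε / 2) ⊆ I := by
    rw [uIcc_of_le (by linarith)]
    refine (fun x hx => hb ?_)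
    rw [Real.ball_eq_Ioo]
    constructor <;> linarith [hx.1, hx.2]
  refine ⟨{x | ¬ (x ∈ uIcc (s - ε / 2) (s + ε / 2) → DifferentiableAt ℝ g x)}, ?_,
    (hAC _ _ hsub).ae_differentiableAt⟩
  refine mem_nhdsWithin.2 ⟨Ioo (s - ε / 2) (s + ε / 2), isOpen_Ioo,
    ⟨by linarith, by linarith⟩, fun x hx h => hx.2.2 (h ?_)⟩
  rw [uIcc_of_le (by linarith)]
  exact Ioo_subset_Icc_self hx.1

lemma ae_differentiableAt_down (hf : IsDecreasingDensity f xi xf)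
    (hAC : ∀ a c : ℝ, uIcc a c ⊆ downSupport α f →
      AbsolutelyContinuousOnInterval (down α f) a c) :
    ∀ᵐ x, x ∈ interval xi xf → DifferentiableAt ℝ (down α f) (downVar α f x) := by
  set ψ := Function.invFunOn (downVar α f) (interval xi xf)
  have hψ : ∀ x ∈ interval xi xf, ψ (downVar α f x) = x := fun x hx =>
    (hf.strictMonoOn_downVar α).injOn.leftInvOn_invFunOn hx
  have hN := ae_differentiableAt_of_locally_absolutelyContinuous (hf.isOpen_downSupport α) hAC
  have hψd : DifferentiableOn ℝ ψ (downSupport α f) := by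
    rw [hf.downSupport_eq]
    rintro _ ⟨x, hx, rfl⟩
    exact (hasDerivAt_of_comp_eq (isOpen_interval _ _) (ordConnected_interval _ _)
      (hf.strictMonoOn_downVar α) (hf.continuousOn_downVar α) (φ := id) hψ hx
      (hf.hasDerivAt_downVar α hx) (hf.deriv_downVar_pos α x hx).ne'
      (hasDerivAt_id x)).differentiableAt.differentiableWithinAt
  -- The exceptional set lives in the variable s; the inverse change of variable is differentiable,
  -- hence carries null sets to null sets.
  have himg := addHaar_image_eq_zero_of_differentiableOn_of_addHaar_eq_zero volume
    (hψd.mono fun s hs => hs.1) hN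
  refine measure_mono_null (fun x hx => ?_) himg
  simp only [mem_compl_iff, mem_ofPred_eq, Classical.not_imp] at hx
  refine ⟨downVar α f x, ⟨?_, hx.2⟩, hψ x hx.1⟩
  rw [hf.downSupport_eq]
  exact mem_image_of_mem _ hx.1

lemma deriv_down (hf : IsDecreasingDensity f xi xf) {x : ℝ} (hx : x ∈ interval xi xf)
    (hd : DifferentiableAt ℝ (down α f) (downVar α f x)) :
    deriv (down α f) (downVar α f x) * (f x ^ (1 - α) * |deriv f x|) =
      -(f x ^ (α - 1) * (α - f x * deriv (deriv f) x / deriv f x ^ 2)) := by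
  have h0 := hf.pos x hx
  have hneg := hf.deriv_neg x hx
  have hfd := (hf.differentiable x hx).hasDerivAt
  have hnhds := (isOpen_interval xi xf).mem_nhds hx
  have hcomp := hd.hasDerivAt.comp x (hf.hasDerivAt_downVar α hx)
  -- Twice differentiability of f is not assumed: it follows at this point from f' = -f^α/g(s), once
  -- `g` is differentiable at s(x).
  have hev : deriv f =ᶠ[𝓝 x] fun y => -(f y ^ α / (down α f ∘ downVar α f) y) := by
    filter_upwards [hnhds] with y hy
    have h1 := hf.pos y hy
    have h2 := hf.deriv_neg y hy
    have h3 := Real.rpow_pos_of_pos h1 α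
    rw [Function.comp_apply, hf.down_downVar α hy, abs_of_neg h2]
    field_simp
  have hdne : (down α f ∘ downVar α f) x ≠ 0 := by
    rw [Function.comp_apply, hf.down_downVar α hx]
    exact (mul_pos (Real.rpow_pos_of_pos h0 _) (inv_pos.2 (abs_pos.2 hneg.ne))).ne'
  have hfα : HasDerivAt (fun y => f y ^ α) (deriv f x * α * f x ^ (α - 1)) x :=
    hfd.rpow_const (Or.inl h0.ne')
  have hdd : DifferentiableAt ℝ (deriv f) x :=
    (hfα.div hcomp hdne).neg.differentiableAt.congr_of_eventuallyEq hev
  have h2 := hfα.mul ((hdd.hasDerivAt.neg).inv (neg_ne_zero.2 hneg.ne))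
  have hev2 : (down α f ∘ downVar α f) =ᶠ[𝓝 x] fun y => f y ^ α * (-deriv f y)⁻¹ := by
    filter_upwards [hnhds] with y hy
    rw [Function.comp_apply, hf.down_downVar α hy, abs_of_neg (hf.deriv_neg y hy)]
  have h3 := hcomp.unique (h2.congr_of_eventuallyEq hev2)
  rw [h3]
  have h4 : f x ^ α = f x ^ (α - 1) * f x := by
    rw [← Real.rpow_add_one h0.ne', sub_add_cancel]
  simp only [Pi.neg_apply, Pi.inv_apply]
  rw [h4]
  have := hneg.ne
  field_simp
  ring

/-- Here `F`, `e` and `B` stand for f, |f'| and the bracket in the down-Fisher measure. The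
relations αb = β and p(1-b) = q are exactly what matches the exponents. -/
lemma fisher_weight_identity {F e B β q : ℝ} (hF : 0 < F) (he : 0 < e) (hβ : α * b = β)
    (hq : p * (1 - b) = q) :
    F ^ (1 - α) * e *
      (|(F ^ α * e⁻¹) ^ (b - 2) * (-(F ^ (α - 1) * B) / (F ^ (1 - α) * e))| ^ p *
        (F ^ α * e⁻¹)) = F ^ (1 + p * (β - 2)) * e ^ q * |B| ^ p := by
  have h1 : |(F ^ α * e⁻¹) ^ (b - 2) * (-(F ^ (α - 1) * B) / (F ^ (1 - α) * e))| =
      F ^ (β - 2) * e ^ (1 - b) * |B| := by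
    have : (F ^ α * e⁻¹) ^ (b - 2) * (F ^ (α - 1) / (F ^ (1 - α) * e)) =
        F ^ (β - 2) * e ^ (1 - b) := by
      -- Writing both bases as exponentials reduces the identity to a polynomial identity between
      -- exponents.
      obtain ⟨l, rfl⟩ : ∃ l, F = Real.exp l := ⟨_, (Real.exp_log hF).symm⟩
      obtain ⟨m, rfl⟩ : ∃ m, e = Real.exp m := ⟨_, (Real.exp_log he).symm⟩
      simp only [← Real.exp_mul, ← Real.exp_neg, ← Real.exp_add, ← Real.exp_sub]
      congr 1
      rw [← hβ]; ring
    calc _ = |(F ^ α * e⁻¹) ^ (b - 2) * (F ^ (α - 1) / (F ^ (1 - α) * e)) * -B| := by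
          congr 1; ring
      _ = _ := by rw [this, abs_mul, abs_neg, abs_of_pos (by positivity)]
  rw [h1, Real.mul_rpow (by positivity) (abs_nonneg _), Real.mul_rpow (by positivity)
    (by positivity), ← Real.rpow_mul hF.le, ← Real.rpow_mul he.le]
  have h2 : F ^ (1 - α) * F ^ α = F := by
    rw [← Real.rpow_add hF, sub_add_cancel, Real.rpow_one]
  rw [Real.rpow_add hF, Real.rpow_one, mul_comm p (β - 2), mul_comm (1 - b) p, hq]
  calc _ = (F ^ (1 - α) * F ^ α) * (e * e⁻¹) * (F ^ ((β - 2) * p) * e ^ q * |B| ^ p) := by ring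
    _ = _ := by rw [h2, mul_inv_cancel₀ he.ne']; ring

lemma fisherF_down (hf : IsDecreasingDensity f xi xf) {q β : ℝ}
    (hg : IsIntervalDensity (down α f) (downSupport α f))
    (hAC : ∀ a c : ℝ, uIcc a c ⊆ downSupport α f →
      AbsolutelyContinuousOnInterval (down α f) a c)
    (hα : p * β / (p - q) = α) (hβ : α * b = β) (hq : p * (1 - b) = q) :
    fisherF p b (down α f) = downFisher p q β f := by
  have hm := (isOpen_interval xi xf).measurableSet
  rw [fisherF, hg.support_eq, downFisher, hf.support_eq, hf.downSupport_eq,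
    lintegral_image_eq_lintegral_abs_deriv_mul hm
      (fun x hx => (hf.hasDerivAt_downVar α hx).hasDerivWithinAt) (hf.strictMonoOn_downVar α).injOn]
  refine setLIntegral_congr_fun_ae hm ?_
  filter_upwards [hf.ae_differentiableAt_down hAC] with x hd hx
  have h0 := hf.pos x hx
  have he := abs_pos.2 (hf.deriv_neg x hx).ne
  have hs := hf.deriv_downVar_pos α x hx
  have hD := hf.deriv_down hx (hd hx)
  rw [← eq_div_iff hs.ne'] at hD
  rw [← ENNReal.ofReal_mul (abs_nonneg _), abs_of_pos hs, hD, hf.down_downVar α hx, hα,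
    fisher_weight_identity h0 he hβ hq]

end IsDecreasingDensity

/-! ### The equality case and the inversion by the up transform -/

/-- A density whose power `g ^ b` is a multiple of the transported stretched Gaussian is a rescaled
deformed Gaussian. -/
lemma exists_eq_rescale_deformedGaussian {g T : ℝ → ℝ} {I : Set ℝ} {p b K : ℝ}
    (hg : IsIntervalDensity g I) (hp : 1 ≤ p) (hb : b ≠ 0) (hTI : T '' I = gaussSupport p)
    (hTd : ∀ s ∈ I, HasDerivAt T (g s / stretchedGaussian p (T s)) s) (hK : 0 < K)
    (hgK : ∀ s ∈ I, g s ^ b = K * stretchedGaussian p (T s)) :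
    ∃ r m : ℝ, 0 < r ∧ rescale r m (deformedGaussian p b) = g := by
  have hG := isIntervalDensity_stretchedGaussian hp
  have hTJ : ∀ s ∈ I, T s ∈ gaussSupport p := fun s hs => hTI ▸ mem_image_of_mem T hs
  set r := K ^ (1 / b) with hr
  have hr0 : 0 < r := Real.rpow_pos_of_pos hK _
  have hgr : ∀ s ∈ I, g s = r * stretchedGaussian p (T s) ^ (1 / b) := fun s hs => by
    rw [hr, ← Real.mul_rpow hK.le (hG.pos _ (hTJ s hs)).le, ← hgK s hs,
      ← Real.rpow_mul (hg.pos s hs).le, mul_one_div_cancel hb, Real.rpow_one]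
  -- With g = r G(T)^{1/b}, the derivative of `gaussVar p b ∘ T` is G(T)^{1-1/b} g/G(T) = r, so this
  -- composition is affine with slope r.
  obtain ⟨k, hk⟩ := exists_eq_add_const_of_hasDerivAt hg.ordConnected
    (A := fun s => gaussVar p b (T s)) (B := fun s => r * s) (d := fun _ => r) (fun s hs => by
      have hw := hG.pos _ (hTJ s hs)
      refine ((hasDerivAt_gaussVar hp (hTJ s hs)).comp s (hTd s hs)).congr_deriv ?_
      have h1 : stretchedGaussian p (T s) ^ (1 - 1 / b) * stretchedGaussian p (T s) ^ (1 / b) =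
          stretchedGaussian p (T s) := by
        rw [← Real.rpow_add hw, sub_add_cancel, Real.rpow_one]
      rw [hgr s hs, ← mul_div_assoc, mul_left_comm, h1, mul_div_assoc, div_self hw.ne', mul_one])
    (fun s _ => by simpa using (hasDerivAt_id s).const_mul r)
  have hX : ∀ s ∈ I, r * (s - -k / r) = gaussVar p b (T s) := fun s hs => by
    have := hk s hs
    rw [this]; field_simp; ring
  refine ⟨r, -k / r, hr0, funext fun s => ?_⟩
  rw [rescale]
  by_cases hs : s ∈ I
  · rw [hX s hs, deformedGaussian_gaussVar hp (hTJ s hs), hgr s hs]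
  · rw [deformedGaussian_of_notMem hp, mul_zero, hg.zero s hs]
    rw [← hTI, image_image]
    rintro ⟨s', hs', he⟩
    have h1 := mul_left_cancel₀ hr0.ne' ((hX s' hs').trans he)
    exact hs ((show s' = s by linarith) ▸ hs')

namespace IsDecreasingDensity

variable {f : ℝ → ℝ} {xi : ℝ} {xf : EReal} {α : ℝ}

lemma continuousOn_deriv_downVar (hf : IsDecreasingDensity f xi xf)
    (hg : IsIntervalDensity (down α f) (downSupport α f)) :
    ContinuousOn (fun x => f x ^ (1 - α) * |deriv f x|) (interval xi xf) := by
  have hmaps : MapsTo (downVar α f) (interval xi xf) (downSupport α f) := fun x hx => by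
    rw [hf.downSupport_eq]; exact mem_image_of_mem _ hx
  refine (hf.isIntervalDensity.continuousOn.div
    (hg.continuousOn.comp (hf.continuousOn_downVar α) hmaps)
    fun x hx => (hg.pos _ (hmaps hx)).ne').congr fun x hx => ?_
  have h1 := hf.deriv_downVar_mul_down α hx
  exact eq_div_of_mul_eq (hg.pos _ (hmaps hx)).ne' h1

/-- Substituting v = s(y), the weight equals 1/f(y) and g(v) dv = f(y) dy, so the integrand becomes
1. The sign of `x₁ - x` is the source of the reflection. -/
lemma upVar_down (hf : IsDecreasingDensity f xi xf)
    (hg : IsIntervalDensity (down α f) (downSupport α f)) {x x₁ : ℝ} (hx : x ∈ interval xi xf)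
    (hx₁ : x₁ ∈ interval xi xf) :
    upVar α (down α f) (downVar α f x₁) (downVar α f x) = x₁ - x := by
  have hsub : uIcc x x₁ ⊆ interval xi xf := (ordConnected_interval _ _).uIcc_subset hx hx₁
  have himg : downVar α f '' uIcc x x₁ ⊆ downSupport α f := by
    rw [hf.downSupport_eq]; exact image_mono hsub
  have hd : ∀ y ∈ uIcc x x₁, HasDerivAt (downVar α f) (f y ^ (1 - α) * |deriv f y|) y :=
    fun y hy => hf.hasDerivAt_downVar α (hsub hy)
  have hc := (hf.continuousOn_deriv_downVar hg).mono hsub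
  have hgc := hg.continuousOn.mono himg
  have hone : ∫ _ in x..x₁, (1 : ℝ) = x₁ - x := by simp
  rw [upVar, ← hone]
  by_cases hα : α = 2
  · rw [if_pos hα]
    refine (intervalIntegral.integral_comp_mul_deriv' hd hc
      (Real.continuous_exp.continuousOn.mul hgc)).symm.trans ?_
    refine intervalIntegral.integral_congr fun y hy => ?_
    have h0 := hf.pos y (hsub hy)
    have h1 := hf.deriv_downVar_mul_down α (hsub hy)
    have h2 : Real.exp (downVar α f y) = (f y)⁻¹ := by
      rw [downVar, if_pos hα, Real.exp_neg, Real.exp_log h0]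
    simp only [Function.comp_apply, Pi.mul_apply]
    rw [h2, mul_assoc, mul_comm (down α f _), h1, inv_mul_cancel₀ h0.ne']
  · have hα' : α - 2 ≠ 0 := sub_ne_zero.2 hα
    have hv : ∀ y ∈ interval xi xf, (α - 2) * downVar α f y = f y ^ (2 - α) := fun y _ => by
      rw [downVar, if_neg hα, mul_div_cancel₀ _ hα']
    have hpc : ContinuousOn (fun v => |(α - 2) * v| ^ (1 / (α - 2)))
        (downVar α f '' uIcc x x₁) := by
      refine ContinuousOn.rpow_const (by fun_prop) ?_
      rintro _ ⟨y, hy, rfl⟩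
      left
      rw [hv y (hsub hy)]
      exact (abs_pos.2 (Real.rpow_pos_of_pos (hf.pos y (hsub hy)) _).ne').ne'
    rw [if_neg hα]
    refine (intervalIntegral.integral_comp_mul_deriv' hd hc (hpc.mul hgc)).symm.trans ?_
    refine intervalIntegral.integral_congr fun y hy => ?_
    have h0 := hf.pos y (hsub hy)
    have h1 := hf.deriv_downVar_mul_down α (hsub hy)
    have h2 : |(α - 2) * downVar α f y| ^ (1 / (α - 2)) = (f y)⁻¹ := by
      rw [hv y (hsub hy), abs_of_pos (Real.rpow_pos_of_pos h0 _), ← Real.rpow_mul h0.le,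
        show (2 - α) * (1 / (α - 2)) = -1 by field_simp; ring, Real.rpow_neg_one]
    simp only [Function.comp_apply, Pi.mul_apply]
    rw [h2, mul_assoc, mul_comm (down α f _), h1, inv_mul_cancel₀ h0.ne']

/-- The up transformation inverts the down transformation, up to a translation and a reflection. -/
lemma eq_up_down (hf : IsDecreasingDensity f xi xf)
    (hg : IsIntervalDensity (down α f) (downSupport α f)) {x₁ : ℝ}
    (hx₁ : x₁ ∈ interval xi xf) (x : ℝ) :
    f x = up α (down α f) (downVar α f x₁) (x₁ - x) := by
  set U := upVar α (down α f) (downVar α f x₁) with hU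
  have hUs : ∀ y ∈ interval xi xf, U (downVar α f y) = x₁ - y := fun y hy =>
    hf.upVar_down hg hy hx₁
  have himg : x₁ - x ∈ U '' downSupport α f ↔ x ∈ interval xi xf := by
    rw [hf.downSupport_eq, image_image]
    refine ⟨?_, fun hx => ⟨x, hx, hUs x hx⟩⟩
    rintro ⟨y, hy, he⟩
    have h1 := (hUs y hy).symm.trans he
    exact (show y = x by linarith) ▸ hy
  have hinj : InjOn U (downSupport α f) := by
    rw [hf.downSupport_eq]
    rintro _ ⟨y, hy, rfl⟩ _ ⟨z, hz, rfl⟩ he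
    rw [hUs y hy, hUs z hz] at he
    rw [show y = z by linarith]
  rw [up, hg.support_eq]
  by_cases hx : x ∈ interval xi xf
  · have hs : downVar α f x ∈ downSupport α f := by
      rw [hf.downSupport_eq]; exact mem_image_of_mem _ hx
    have h0 := hf.pos x hx
    rw [if_pos (himg.2 hx), ← hUs x hx, hinj.leftInvOn_invFunOn hs, downVar]
    split_ifs with hα
    · rw [neg_neg, Real.exp_log h0]
    · have hα' : α - 2 ≠ 0 := sub_ne_zero.2 hα
      have hα'' : 2 - α ≠ 0 := fun h => hα' (by linarith)
      rw [mul_div_cancel₀ _ hα', abs_of_pos (Real.rpow_pos_of_pos h0 _),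
        ← Real.rpow_mul h0.le, mul_one_div_cancel hα'', Real.rpow_one]
  · rw [if_neg (fun h => hx (himg.1 h)), hf.zero x hx]

end IsDecreasingDensity

/-! ### The regularity hypothesis in the form required by `stam` -/

namespace RegularDown

variable {f : ℝ → ℝ} {xi : ℝ} {xf : EReal} {p q α : ℝ}

lemma absolutelyContinuousOnInterval (h : RegularDown p q α f) (hqp : q ≠ p) :
    ∀ a c : ℝ, uIcc a c ⊆ downSupport α f → AbsolutelyContinuousOnInterval (down α f) a c := by
  rcases lt_or_gt_of_ne hqp with hlt | hlt
  · exact fun a c _ => h.1 hlt a c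
  · exact (h.2 hlt).1

/-- For q < p the extension by zero is continuous, so every boundary limit is 0; for q > p the claim
is part of the hypothesis. -/
lemma not_tendsto (h : RegularDown p q α f) (hqp : q ≠ p) (hI : IsOpen (downSupport α f)) :
    ∀ e ∈ frontier (downSupport α f), ∀ L : ℝ, 0 < L →
      ¬ Tendsto (down α f) (𝓝[downSupport α f] e) (𝓝 L) := by
  rcases lt_or_gt_of_ne hqp with hlt | hlt
  · intro e he L hL hT
    rw [hI.frontier_eq] at he
    have : (𝓝[downSupport α f] e).NeBot := mem_closure_iff_nhdsWithin_neBot.1 he.1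
    have hc : ContinuousAt (down α f) e := by
      refine (h.1 hlt (e - 1) (e + 1)).continuousOn.continuousAt ?_
      rw [uIcc_of_le (by linarith)]
      exact Icc_mem_nhds (by linarith) (by linarith)
    have h0 : down α f e = 0 := IsDecreasingDensity.down_of_notMem he.2
    have h1 := hc.tendsto.mono_left (nhdsWithin_le_nhds (s := downSupport α f))
    rw [h0] at h1
    exact hL.ne (tendsto_nhds_unique h1 hT)
  · exact (h.2 hlt).2

end RegularDown

end DownFisher

/-! ### The down-Fisher–Shannon inequality -/

theorem mainTheorem7 (f : ℝ → ℝ) (xi : ℝ) (xf : EReal)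
    (hf : DownFisher.IsDecreasingDensity f xi xf)
    (p q β α : ℝ) (hp : 1 ≤ p) (hqp : q ≠ p) (hα : α = β * p / (p - q))
    (hreg : DownFisher.RegularDown p q α f)
    (hS : IntegrableOn (fun x => f x * Real.log (f x)) (Function.support f))
    (hL : IntegrableOn (fun x => f x * Real.log |deriv f x|) (Function.support f)) :
    DownFisher.kappa p ((p - q) / p) ≤
      DownFisher.downFisher p q β f ^ (1 / p) *
        ENNReal.ofReal (Real.exp (β * DownFisher.shannon f)) *
        ENNReal.ofReal (Real.exp ((p - q) / p * DownFisher.meanLogDeriv f)) ∧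
    (DownFisher.downFisher p q β f ^ (1 / p) *
        ENNReal.ofReal (Real.exp (β * DownFisher.shannon f)) *
        ENNReal.ofReal (Real.exp ((p - q) / p * DownFisher.meanLogDeriv f)) =
      DownFisher.kappa p ((p - q) / p) →
      ∃ r m x₀ c : ℝ, 0 < r ∧
        x₀ ∈ Function.support
          (DownFisher.rescale r m (DownFisher.deformedGaussian p ((p - q) / p))) ∧
        ∀ x, f x = DownFisher.up α
          (DownFisher.rescale r m (DownFisher.deformedGaussian p ((p - q) / p))) x₀ (c - x)) := by
  have hp0 : p ≠ 0 := by linarith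
  have hpq : p - q ≠ 0 := sub_ne_zero.2 hqp.symm
  set b := (p - q) / p with hbdef
  have hb : b ≠ 0 := div_ne_zero hpq hp0
  have hβ : α * b = β := by rw [hα, hbdef]; field_simp
  have hq : p * (1 - b) = q := by rw [hbdef]; field_simp; ring
  have hα' : p * β / (p - q) = α := by rw [hα, mul_comm]
  have hI := hf.isOpen_downSupport α
  have hAC := hreg.absolutelyContinuousOnInterval hqp
  have hgc : ContinuousOn (DownFisher.down α f) (DownFisher.downSupport α f) := fun s hs => by
    obtain ⟨ε, hε, hball⟩ := Metric.isOpen_iff.1 hI s hs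
    have hsub : uIcc (s - ε / 2) (s + ε / 2) ⊆ DownFisher.downSupport α f := by
      rw [uIcc_of_le (by linarith)]
      refine fun x hx => hball ?_
      rw [Real.ball_eq_Ioo]
      constructor <;> linarith [hx.1, hx.2]
    refine ((hAC _ _ hsub).continuousOn.continuousAt ?_).continuousWithinAt
    rw [uIcc_of_le (by linarith)]
    exact Icc_mem_nhds (by linarith) (by linarith)
  have hg := hf.isIntervalDensity_down hgc
  obtain ⟨hle, heq⟩ := DownFisher.stam hg hp hb hAC (hreg.not_tendsto hqp hI)
    (hf.integrableOn_down_mul_log α hS hL)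
  have hexp : ENNReal.ofReal (Real.exp (b * DownFisher.shannon (DownFisher.down α f))) =
      ENNReal.ofReal (Real.exp (β * DownFisher.shannon f)) *
        ENNReal.ofReal (Real.exp (b * DownFisher.meanLogDeriv f)) := by
    rw [← ENNReal.ofReal_mul (Real.exp_pos _).le, ← Real.exp_add, hf.shannon_down hg hS hL, ← hβ]
    congr 2
    ring
  rw [hf.fisherF_down hg hAC hα' hβ hq, hexp, ← mul_assoc] at hle heq
  refine ⟨hle, fun h => ?_⟩
  obtain ⟨T, hTI, hTd, K, hK, hgK⟩ := heq h
  obtain ⟨r, m, hr, hrm⟩ :=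
    DownFisher.exists_eq_rescale_deformedGaussian hg hp hb hTI hTd hK hgK
  obtain ⟨x₁, hx₁⟩ := hf.isIntervalDensity.nonempty
  -- Any `x₁` in the support of f serves: normalizing the up variable at s(x₁) makes the translation
  -- constant equal to `x₁`.
  refine ⟨r, m, DownFisher.downVar α f x₁, x₁, hr, ?_, ?_⟩
  · rw [hrm, hg.support_eq, hf.downSupport_eq]
    exact mem_image_of_mem _ hx₁
  · rw [hrm]
    exact hf.eq_up_down hg hx₁
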